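/- Work in ZF (no Axiom of Choice). Cardinals are initial ordinals, and regular cardinals are infinite. For an ordinal $\delta$, $\mathrm{cf}(\delta)$ is the least ordertype of a cofinal subset of $\delta$. For an ordinal $\lambda$ and a function $f$ from a set of regular cardinals to the ordinals, let $\phi(\lambda,f)$ be the statement that there is a sequence $\langle c_\delta : \delta<\lambda,\ \mathrm{cf}(\delta)\in\mathrm{dom}(f)\rangle$ such that each $c_\delta$ is a cofinal subset of $\delta$ of ordertype less than $f(\mathrm{cf}(\delta))$. Let $\psi(\lambda,\theta)$ be the statement $\phi(\lambda,\{(\theta,\theta+1)\})$, where $\theta+1$ is the ordinal successor of $\theta$. A tree is a set $T$ of functions whose domains are ordinals such that $t\restriction\alpha\in T$ whenever $t\in T$ and $\alpha\in\mathrm{dom}(t)$; a branch through $T$ is a subset of $T$ whose elements are pairwise comparable under $\subseteq$, and it is maximal if it is not properly contained in another branch. For an ordinal $\gamma$, $\mathrm{DC}_\gamma$ is the statement that for every set $X$, every tree $T\subseteq{}^{<\gamma}X$ has a maximal branch. **Corollary 3.2.** Suppose that $\theta\ge\aleph_0$ is a regular cardinal such that $\mathrm{DC}_\theta$ holds, that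 $\lambda$ is an ordinal with $\mathrm{cf}(\lambda)>\theta$, and that $A$ is the set of regular cardinals in the interval $[\theta,\lambda)$. Then $\psi(\lambda,\theta)$ implies $\phi(\lambda,f)$, where $f$ is the cardinal successor function $\kappa\mapsto\kappa^+$ on $A$. -/

import Mathlib

/-! The result is a theorem of ZF (no axiom of choice), whereas the ambient logic has choice.
So it is stated for an arbitrary model of first-order ZF: a type `M` with a binary relation `∈`
on it that satisfies the axioms. All notions below (ordinal, cofinality, `DC`, ...) are the
internal ones of the model: quantifiers range over `M`, and functions, sequences, trees etc. are
elements of `M`. -/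

namespace SetModel

/-! ### First-order ZF -/

/-- The only symbol of the language of set theory is a binary relation symbol. -/
inductive MemSymb : ℕ → Type
  | mem : MemSymb 2

/-- The first-order language `{∈}`. -/
def setLang : FirstOrder.Language := ⟨fun _ => Empty, MemSymb⟩

/-- The membership symbol. -/
abbrev memSymb : setLang.Relations 2 := MemSymb.mem

/-- A type with a membership relation is a structure for the language `{∈}`. -/
instance setStructure (M : Type*) [Membership M M] : setLang.Structure M where
  funMap := fun s => Empty.elim s
  RelMap := fun r => match r with
    | MemSymb.mem => fun v => v 0 ∈ v 1

section

variable {M : Type*} [Membership M M]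

def Sub (x y : M) : Prop := ∀ z, z ∈ x → z ∈ y

/-- `z = {x, y}`. -/
def IsUPair (z x y : M) : Prop := ∀ w, w ∈ z ↔ w = x ∨ w = y

def IsEmptySet (x : M) : Prop := ∀ z, ¬ z ∈ x

/-- `y = x ∪ {x}`. -/
def IsSucc (y x : M) : Prop := ∀ z, z ∈ y ↔ z ∈ x ∨ z = x

end

/-- `(M, ∈)` is a model of Zermelo-Fraenkel set theory without choice. Separation and replacement
are the first-order schemas: they range over the classes and the binary relations that are
first-order definable over `(M, ∈)` with parameters from `M`. -/
structure IsModelZF (M : Type*) [Membership M M] : Prop where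
  extensionality : ∀ x y : M, (∀ z, z ∈ x ↔ z ∈ y) → x = y
  foundation : ∀ x : M, (∃ y, y ∈ x) → ∃ y, y ∈ x ∧ ∀ z, z ∈ x → ¬ z ∈ y
  pairing : ∀ x y : M, ∃ z, IsUPair z x y
  union : ∀ x : M, ∃ u : M, ∀ z, z ∈ u ↔ ∃ y, y ∈ x ∧ z ∈ y
  powerset : ∀ x : M, ∃ p : M, ∀ z, z ∈ p ↔ Sub z x
  infinity : ∃ w : M, (∃ e, e ∈ w ∧ IsEmptySet e) ∧ ∀ x, x ∈ w → ∃ y, y ∈ w ∧ IsSucc y x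
  separation : ∀ P : Set M, (Set.univ : Set M).Definable₁ setLang P →
    ∀ a : M, ∃ b : M, ∀ z, z ∈ b ↔ z ∈ a ∧ z ∈ P
  replacement : ∀ R : Set (M × M), (Set.univ : Set M).Definable₂ setLang R →
    ∀ a : M, (∀ x, x ∈ a → ∀ y y', (x, y) ∈ R → (x, y') ∈ R → y = y') →
      ∃ b : M, ∀ y, y ∈ b ↔ ∃ x, x ∈ a ∧ (x, y) ∈ R

section

variable {M : Type*} [Membership M M]

/-! ### Functions in the model -/

/-- `p` is the (Kuratowski) ordered pair `(x, y) = {{x}, {x, y}}`. -/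
def IsPair (p x y : M) : Prop := ∀ z, z ∈ p ↔ IsUPair z x x ∨ IsUPair z x y

/-- `(x, y) ∈ f`; for a function `f`, this says that `x ∈ dom f` and `f(x) = y`. -/
def Maps (f x y : M) : Prop := ∃ p, p ∈ f ∧ IsPair p x y

/-- `f` is a function: a set of ordered pairs that is single-valued. -/
def IsFunction (f : M) : Prop :=
  (∀ p, p ∈ f → ∃ x y, IsPair p x y) ∧ ∀ x y y', Maps f x y → Maps f x y' → y = y'

/-- `d = dom f`. -/
def IsDomain (f d : M) : Prop := ∀ x, x ∈ d ↔ ∃ y, Maps f x y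

/-- `r = ran f`. -/
def IsRange (f r : M) : Prop := ∀ y, y ∈ r ↔ ∃ x, Maps f x y

/-- `s` is the restriction of the function `t` to `a`. -/
def IsRestriction (s t a : M) : Prop :=
  IsFunction s ∧ ∀ x y, Maps s x y ↔ x ∈ a ∧ Maps t x y

/-- `g` is a bijection from `a` to `b`. -/
def IsBijection (g a b : M) : Prop :=
  IsFunction g ∧ IsDomain g a ∧ IsRange g b ∧ ∀ x x' y, Maps g x y → Maps g x' y → x = x'

/-! ### Ordinals and cardinals in the model -/

/-- Von Neumann ordinals: transitive sets that are linearly ordered (hence, by foundation,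
well-ordered) by `∈`. -/
def IsOrdinal (a : M) : Prop :=
  (∀ x, x ∈ a → Sub x a) ∧ ∀ x y, x ∈ a → y ∈ a → x ∈ y ∨ x = y ∨ y ∈ x

/-- `a ≤ b`, for ordinals; the strict order of ordinals is `∈`. -/
def OrdLe (a b : M) : Prop := a = b ∨ a ∈ b

/-- `w = ω`: an ordinal that contains `∅`, is closed under successors, and all of whose elements
are `∅` or successors of elements of `w`. -/
def IsOmega (w : M) : Prop :=
  IsOrdinal w ∧ (∃ e, e ∈ w ∧ IsEmptySet e) ∧ (∀ x, x ∈ w → ∃ y, y ∈ w ∧ IsSucc y x) ∧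
    ∀ y, y ∈ w → IsEmptySet y ∨ ∃ x, x ∈ w ∧ IsSucc y x

/-- The set of ordinals `x` has ordertype `a`: there is an increasing function from the ordinal
`a` onto `x`. -/
def HasOrderType (x a : M) : Prop :=
  IsOrdinal a ∧ ∃ g, IsFunction g ∧ IsDomain g a ∧ IsRange g x ∧
    ∀ b c y z, b ∈ c → Maps g b y → Maps g c z → y ∈ z

/-- `c` is a cofinal subset of the ordinal `d`. -/
def IsCofinalIn (c d : M) : Prop := Sub c d ∧ ∀ a, a ∈ d → ∃ b, b ∈ c ∧ OrdLe a b

/-- `k = cf(d)`: the least ordertype of a cofinal subset of the ordinal `d`. -/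
def IsCofinality (k d : M) : Prop :=
  (∃ c, IsCofinalIn c d ∧ HasOrderType c k) ∧
    ∀ c m, IsCofinalIn c d → HasOrderType c m → OrdLe k m

/-- Cardinals are initial ordinals. -/
def IsCardinal (k : M) : Prop := IsOrdinal k ∧ ∀ a, a ∈ k → ¬ ∃ g, IsBijection g a k

/-- Regular cardinals: `k ≥ ℵ₀` and `cf(k) = k`. -/
def IsRegularCardinal (k : M) : Prop :=
  IsCardinal k ∧ (∃ w, IsOmega w ∧ OrdLe w k) ∧ IsCofinality k k

/-- `m = k⁺`, the least cardinal greater than `k`. -/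
def IsCardinalSucc (m k : M) : Prop :=
  IsCardinal m ∧ k ∈ m ∧ ∀ n, IsCardinal n → k ∈ n → OrdLe m n

/-- `A` is the set of regular cardinals in the interval `[θ, l)`. -/
def IsRegularInterval (A θ l : M) : Prop :=
  ∀ k, k ∈ A ↔ IsRegularCardinal k ∧ OrdLe θ k ∧ k ∈ l

/-- `f` is the cardinal successor function `k ↦ k⁺` on the set `A`. -/
def IsCardinalSuccOn (f A : M) : Prop :=
  IsFunction f ∧ IsDomain f A ∧ ∀ k m, Maps f k m → IsCardinalSucc m k

/-! ### Trees and dependent choice -/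

/-- `T` is a tree with `T ⊆ ^{<γ}X`: a set of functions into `X` whose domains are elements of the
ordinal `γ`, closed under restrictions to elements of their domains. -/
def IsTree (T γ X : M) : Prop :=
  ∀ t, t ∈ T → IsFunction t ∧ (∀ x y, Maps t x y → y ∈ X) ∧
    ∃ d, d ∈ γ ∧ IsDomain t d ∧ ∀ a, a ∈ d → ∃ s, s ∈ T ∧ IsRestriction s t a

/-- `b` is a branch through `T`: a set of pairwise compatible elements of `T`. -/
def IsBranch (b T : M) : Prop :=
  Sub b T ∧ ∀ s t, s ∈ b → t ∈ b → Sub s t ∨ Sub t s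

/-- `b` is a branch through `T` that is not properly contained in another branch. -/
def IsMaximalBranch (b T : M) : Prop :=
  IsBranch b T ∧ ∀ b', IsBranch b' T → Sub b b' → b' = b

/-- `DC_γ`: every tree `T ⊆ ^{<γ}X`, for any set `X`, has a maximal branch. -/
def DC (γ : M) : Prop := ∀ X T : M, IsTree T γ X → ∃ b, IsMaximalBranch b T

/-! ### Ladder systems -/

/-- `d ∈ C^l_{dom f}`: `d` is an ordinal below `l` whose cofinality is in the domain of `f`. -/
def InCofDomain (d l f : M) : Prop := d ∈ l ∧ ∃ k n, IsCofinality k d ∧ Maps f k n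

/-- The sequence `C = ⟨c_d : d ∈ C^l_{dom f}⟩` witnesses `φ(l, f)`: each `c_d` is a cofinal subset
of `d` of ordertype less than `f(cf(d))`. -/
def WitnessesPhi (C l f : M) : Prop :=
  IsFunction C ∧ (∀ d, (∃ c, Maps C d c) ↔ InCofDomain d l f) ∧
    ∀ d c k n, Maps C d c → IsCofinality k d → Maps f k n →
      IsCofinalIn c d ∧ ∃ a, HasOrderType c a ∧ a ∈ n

/-- The statement `φ(l, f)`. -/
def Phi (l f : M) : Prop := ∃ C, WitnessesPhi C l f

/-- The statement `ψ(l, θ)`, which is `φ(l, {(θ, θ + 1)})`. -/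
def Psi (l θ : M) : Prop :=
  ∃ f, (∃ n p, IsSucc n θ ∧ IsPair p θ n ∧ IsUPair f p p) ∧ Phi l f

end

end SetModel

set_option linter.unusedSectionVars false

/-! Let `C` be the sequence of sets `c_a`, for `a < l` of cofinality `θ`, given by `Psi`. At points
of cofinality `θ` it already serves. At `d < l` with `cf(d) = k > θ`, a cofinal set of size at most
`k` has to be defined outright from `d` and `C`, since there is no choice with which to select one
for every `d`.

Call `[x, y)` null if `c_a` misses it for every `a < d` of cofinality `θ` closed under some fixed
monotone `F : d → d`. Null intervals are closed under subintervals and, by taking the pointwise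
maximum of two functions, under adjacent unions. The chosen set consists of those `y < d` for which
no `[x, y)` with `x < y` is null.

It is cofinal (`exists_not_isNull`, `IsEssentialSet.isCofinalIn`). If every `[x, b)` with `x < b <
d` were null, `DC θ` would give an increasing sequence of `b_i`, `i < θ`, with witnesses `F_i`,
whose supremum `a < d` has cofinality `θ` and is closed under every `F_i`. Then `c_a` misses every
`[x, b_i)`, hence `[x, a)`, and is not cofinal in `a`. So for each `x` some `[x, y)` is not null,
and the least such `y` is in the set.

It has size at most `k` (`IsEssentialSet.inj`). Fix `D` cofinal in `d` of type `k` and a monotone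
`F` whose closed points are limits of `D`. Between successive members `b < b'` of the set lies an
element of some `c_a` with `a` closed under `F`, because `F` does not witness that `[b, b')` is
null. There are at most `k` pairs `(a, z)` with `z ∈ c_a`: ordered lexicographically they have type
at most `k`, by regularity of `k` (`inj_of_fibers`). -/

namespace SetModel

open FirstOrder

/-! ### First-order definability with parameters, by instance search -/

section Definability

variable {M : Type*} [Membership M M]

/-- `P` is a first-order definable predicate (with parameters) of an assignment of the variables
`v 0, v 1, …`. -/
class Dfn (P : (ℕ → M) → Prop) : Prop where
  out : (Set.univ : Set M).Definable setLang {v | P v}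

/-- `t` is a first-order definable function (with parameters) of an assignment. -/
class DfnTerm (t : (ℕ → M) → M) : Prop where
  out : Dfn fun v => v 0 = t fun i => v (i + 1)

theorem Dfn.congr {P Q : (ℕ → M) → Prop} (hP : Dfn P) (h : ∀ v, Q v ↔ P v) : Dfn Q := by
  have : Q = P := funext fun v => propext (h v)
  exact this ▸ hP

instance Dfn.not {P : (ℕ → M) → Prop} [h : Dfn P] : Dfn fun v => ¬ P v :=
  ⟨h.out.compl⟩

instance Dfn.and {P Q : (ℕ → M) → Prop} [h : Dfn P] [h' : Dfn Q] : Dfn fun v => P v ∧ Q v :=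
  ⟨h.out.inter h'.out⟩

instance Dfn.or {P Q : (ℕ → M) → Prop} [h : Dfn P] [h' : Dfn Q] : Dfn fun v => P v ∨ Q v :=
  ⟨h.out.union h'.out⟩

instance Dfn.imp {P Q : (ℕ → M) → Prop} [Dfn P] [Dfn Q] : Dfn fun v => P v → Q v :=
  Dfn.congr (P := fun v => ¬ P v ∨ Q v) inferInstance fun _ => imp_iff_not_or

instance Dfn.iff {P Q : (ℕ → M) → Prop} [Dfn P] [Dfn Q] : Dfn fun v => (P v ↔ Q v) :=
  Dfn.congr (P := fun v => (P v → Q v) ∧ (Q v → P v)) inferInstance fun _ => iff_def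

theorem Dfn.relabel {P : (ℕ → M) → Prop} (σ : ℕ → ℕ) (h : Dfn P) :
    Dfn fun v => P fun i => v (σ i) :=
  ⟨h.out.preimage_comp σ⟩

instance DfnTerm.comp {t : (ℕ → M) → M} (σ : ℕ → ℕ) [h : DfnTerm t] :
    DfnTerm fun v => t fun i => v (σ i) :=
  ⟨h.out.relabel fun i => Nat.casesOn i 0 fun i => σ i + 1⟩

instance Dfn.ex {P : (ℕ → M) → M → Prop} [h : Dfn fun w => P (fun i => w (i + 1)) (w 0)] :
    Dfn fun v => ∃ y, P v y := by
  obtain ⟨φ, hφ⟩ := h.out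
  -- De Bruijn convention: variable `0` becomes the bound one, and variable `i + 1` becomes the free
  -- variable `i`.
  refine ⟨⟨(Language.BoundedFormula.relabel (n := 1) (k := 0)
    (fun i : ℕ => Nat.casesOn i (Sum.inr 0) Sum.inl) φ).ex, ?_⟩⟩
  ext v
  simp only [Set.mem_ofPred_eq, Language.Formula.Realize, Language.BoundedFormula.realize_ex]
  refine exists_congr fun y => ?_
  have h1 := Set.ext_iff.1 hφ (fun i => Nat.casesOn i y v)
  simp only [Set.mem_ofPred_eq, Language.Formula.Realize] at h1
  refine h1.trans ?_
  rw [Language.BoundedFormula.realize_relabel]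
  refine iff_of_eq (congrArg₂ _ ?_ (Subsingleton.elim _ _))
  funext i
  cases i <;> simp [Fin.snoc]

instance Dfn.all {P : (ℕ → M) → M → Prop} [h : Dfn fun w => P (fun i => w (i + 1)) (w 0)] :
    Dfn fun v => ∀ y, P v y :=
  Dfn.congr (P := fun v => ¬ ∃ y, ¬ P v y) inferInstance fun _ => not_exists_not.symm

theorem Dfn.eq_var (i j : ℕ) : Dfn fun v : ℕ → M => v i = v j :=
  ⟨⟨(Language.Term.var i).equal (Language.Term.var j), by
    ext v; simp [Language.Formula.Realize, Language.Term.equal]⟩⟩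

theorem Dfn.eq_const (i : ℕ) (c : M) : Dfn fun v : ℕ → M => v i = c :=
  ⟨⟨(Language.Term.var i).equal (Language.Constants.term (setLang.con ⟨c, Set.mem_univ c⟩)), by
    ext v; simp [Language.Formula.Realize, Language.Term.equal]⟩⟩

theorem Dfn.mem_var (i j : ℕ) : Dfn fun v : ℕ → M => v i ∈ v j := by
  refine ⟨Set.Definable.mono (A := ∅) ⟨(Language.Relations.boundedFormula₂ (n := 0)
    (Sum.inl memSymb) (Language.Term.var (Sum.inl i)) (Language.Term.var (Sum.inl j))), ?_⟩
    (Set.empty_subset _)⟩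
  ext v
  simp only [Set.mem_ofPred_eq, Language.Formula.Realize]
  rfl

instance DfnTerm.var (i : ℕ) : DfnTerm fun v : ℕ → M => v i := ⟨Dfn.eq_var 0 (i + 1)⟩

instance DfnTerm.const (c : M) : DfnTerm fun _ : ℕ → M => c := ⟨Dfn.eq_const 0 c⟩

/-- Substitution of definable functions into a definable relation. -/
theorem Dfn.subst₂ {R : M → M → Prop} (hR : Dfn fun v => R (v 0) (v 1))
    (t s : (ℕ → M) → M) [ht : DfnTerm t] [hs : DfnTerm s] : Dfn fun v => R (t v) (s v) := by
  -- Under the two quantifiers of `∃ x y`, `y` is variable `0`, `x` is variable `1`, and the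
  -- original variables are shifted by two.
  have h1 := ht.out.relabel (fun i => Nat.casesOn i 1 fun i => i + 2)
  have h2 := hs.out.relabel (fun i => Nat.casesOn i 0 fun i => i + 2)
  have h3 := hR.relabel (fun i => Nat.casesOn i 1 fun i => i)
  refine Dfn.congr (P := fun v => ∃ x y, x = t v ∧ y = s v ∧ R x y) (@Dfn.ex _ _ _ <|
    @Dfn.ex _ _ _ (@Dfn.and _ _ _ _ h1 (@Dfn.and _ _ _ _ h2 h3))) fun v => ?_
  simp

theorem Dfn.subst₁ {R : M → Prop} (hR : Dfn fun v => R (v 0))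
    (t : (ℕ → M) → M) [ht : DfnTerm t] : Dfn fun v => R (t v) :=
  Dfn.subst₂ (R := fun x _ => R x) hR t t

instance Dfn.eq {t s : (ℕ → M) → M} [DfnTerm t] [DfnTerm s] : Dfn fun v => t v = s v :=
  Dfn.subst₂ (Dfn.eq_var 0 1) t s

instance Dfn.mem {t s : (ℕ → M) → M} [DfnTerm t] [DfnTerm s] : Dfn fun v => t v ∈ s v :=
  Dfn.subst₂ (R := fun x y => x ∈ y) (Dfn.mem_var 0 1) t s

theorem Dfn.definable₁ {P : M → Prop} (h : Dfn fun v => P (v 0)) :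
    (Set.univ : Set M).Definable₁ setLang {x | P x} :=
  h.out.preimage_comp (fun _ : ℕ => (0 : Fin 1))

theorem Dfn.definable₂ {R : M → M → Prop} (h : Dfn fun v => R (v 0) (v 1)) :
    (Set.univ : Set M).Definable₂ setLang {p : M × M | R p.1 p.2} := by
  have := h.out.preimage_comp (fun i : ℕ => (Nat.casesOn i 0 fun _ => 1 : Fin 2))
  exact this

instance Dfn.const (p : Prop) : Dfn fun _ : ℕ → M => p := by
  by_cases hp : p
  · exact Dfn.congr (P := fun v => v 0 = v 0) inferInstance fun _ => by simp [hp]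
  · exact Dfn.congr (P := fun v => ¬ v 0 = v 0) inferInstance fun _ => by simp [hp]

variable (t s r : (ℕ → M) → M) [DfnTerm t] [DfnTerm s] [DfnTerm r]

/-- These instances let the definability side conditions of separation and replacement be found by
instance search. -/
instance : Dfn fun v => Sub (t v) (s v) := by unfold Sub; infer_instance
instance : Dfn fun v => IsUPair (t v) (s v) (r v) := by unfold IsUPair; infer_instance
instance : Dfn fun v => IsPair (t v) (s v) (r v) := by unfold IsPair; infer_instance
instance : Dfn fun v => Maps (t v) (s v) (r v) := by unfold Maps; infer_instance
instance : Dfn fun v => IsFunction (t v) := by unfold IsFunction; infer_instance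
instance : Dfn fun v => IsDomain (t v) (s v) := by unfold IsDomain; infer_instance
instance : Dfn fun v => IsRange (t v) (s v) := by unfold IsRange; infer_instance
instance : Dfn fun v => IsRestriction (t v) (s v) (r v) := by unfold IsRestriction; infer_instance
instance : Dfn fun v => IsOrdinal (t v) := by unfold IsOrdinal; infer_instance
instance : Dfn fun v => OrdLe (t v) (s v) := by unfold OrdLe; infer_instance
instance : Dfn fun v => HasOrderType (t v) (s v) := by unfold HasOrderType; infer_instance
instance : Dfn fun v => IsCofinalIn (t v) (s v) := by unfold IsCofinalIn; infer_instance
instance : Dfn fun v => IsCofinality (t v) (s v) := by unfold IsCofinality; infer_instance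

end Definability

/-! ### Basic set theory in a model of ZF -/

section Sets

variable {M : Type*} [Membership M M] [hM : Fact (IsModelZF M)]

theorem ext {x y : M} (h : ∀ z, z ∈ x ↔ z ∈ y) : x = y := hM.out.extensionality x y h

theorem exists_sep (a : M) (P : M → Prop) [h : Dfn fun v => P (v 0)] :
    ∃ b : M, ∀ z, z ∈ b ↔ z ∈ a ∧ P z :=
  hM.out.separation _ h.definable₁ a

theorem exists_repl (a : M) (R : M → M → Prop) [h : Dfn fun v => R (v 0) (v 1)]
    (hR : ∀ x, x ∈ a → ∀ y y', R x y → R x y' → y = y') :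
    ∃ b : M, ∀ y, y ∈ b ↔ ∃ x, x ∈ a ∧ R x y :=
  hM.out.replacement _ h.definable₂ a hR

theorem exists_insert (a x : M) : ∃ b : M, ∀ z, z ∈ b ↔ z ∈ a ∨ z = x := by
  obtain ⟨s, hs⟩ := hM.out.pairing x x
  obtain ⟨p, hp⟩ := hM.out.pairing a s
  obtain ⟨u, hu⟩ := hM.out.union p
  refine ⟨u, fun z => (hu z).trans ?_⟩
  simp only [hp _, or_and_right, exists_or, exists_eq_left, hs z, or_self]

theorem isUPair_unique {z z' x y : M} (h : IsUPair z x y) (h' : IsUPair z' x y) : z = z' :=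
  ext fun w => (h w).trans (h' w).symm

theorem exists_isPair (x y : M) : ∃ p : M, IsPair p x y := by
  obtain ⟨s, hs⟩ := hM.out.pairing x x
  obtain ⟨t, ht⟩ := hM.out.pairing x y
  obtain ⟨p, hp⟩ := hM.out.pairing s t
  refine ⟨p, fun z => (hp z).trans ⟨?_, ?_⟩⟩
  · rintro (rfl | rfl)
    exacts [Or.inl hs, Or.inr ht]
  · rintro (h | h)
    exacts [Or.inl (isUPair_unique h hs), Or.inr (isUPair_unique h ht)]

/-- The ordered pair `(x, y)`. -/
noncomputable def opair (x y : M) : M := (exists_isPair x y).choose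

theorem isPair_opair (x y : M) : IsPair (opair x y) x y := (exists_isPair x y).choose_spec

theorem isPair_iff {p x y : M} : IsPair p x y ↔ p = opair x y :=
  ⟨fun h => ext fun z => (h z).trans (isPair_opair x y z).symm, fun h => h ▸ isPair_opair x y⟩

theorem opair_inj {x y x' y' : M} : opair x y = opair x' y' ↔ x = x' ∧ y = y' := by
  refine ⟨fun h => ?_, fun ⟨h, h'⟩ => h ▸ h' ▸ rfl⟩
  have h1 := isPair_opair x y
  have h2 := isPair_opair x' y'
  rw [← h] at h2
  obtain ⟨s, hs⟩ := hM.out.pairing x x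
  obtain ⟨t, ht⟩ := hM.out.pairing x y
  obtain ⟨s', hs'⟩ := hM.out.pairing x' x'
  obtain ⟨t', ht'⟩ := hM.out.pairing x' y'
  have e1 : IsUPair s x' x' ∨ IsUPair s x' y' := (h2 s).1 ((h1 s).2 (Or.inl hs))
  have e2 : IsUPair t x' x' ∨ IsUPair t x' y' := (h2 t).1 ((h1 t).2 (Or.inr ht))
  have e3 : IsUPair s' x x ∨ IsUPair s' x y := (h1 s').1 ((h2 s').2 (Or.inl hs'))
  have e4 : IsUPair t' x x ∨ IsUPair t' x y := (h1 t').1 ((h2 t').2 (Or.inr ht'))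
  have hx : x = x' := by
    rcases e1 with e | e
    · simpa using (e x).1 ((hs x).2 (Or.inl rfl))
    · simpa [eq_comm] using (hs x').1 ((e x').2 (Or.inl rfl))
  subst hx
  refine ⟨rfl, ?_⟩
  have f1 : y = x ∨ y = y' := by
    rcases e2 with e | e
    · exact Or.inl (or_self_iff.1 ((e y).1 ((ht y).2 (Or.inr rfl))))
    · exact (e y).1 ((ht y).2 (Or.inr rfl))
  have f2 : y' = x ∨ y' = y := by
    rcases e4 with e | e
    · exact Or.inl (or_self_iff.1 ((e y').1 ((ht' y').2 (Or.inr rfl))))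
    · exact (e y').1 ((ht' y').2 (Or.inr rfl))
  rcases f1 with f1 | f1
  · rcases f2 with f2 | f2
    · rw [f1, f2]
    · exact f2.symm
  · exact f1

theorem maps_iff {f x y : M} : Maps f x y ↔ opair x y ∈ f := by
  simp only [Maps, isPair_iff, exists_eq_right]

instance (t s : (ℕ → M) → M) [DfnTerm t] [DfnTerm s] : DfnTerm fun v => opair (t v) (s v) :=
  ⟨Dfn.congr (P := fun v => IsPair (v 0) (t fun i => v (i + 1)) (s fun i => v (i + 1)))
    (by infer_instance) fun _ => isPair_iff.symm⟩

theorem exists_function (a : M) (R : M → M → Prop) [h : Dfn fun v => R (v 0) (v 1)]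
    (hR : ∀ x, x ∈ a → ∀ y y', R x y → R x y' → y = y') :
    ∃ f : M, IsFunction f ∧ ∀ x y, Maps f x y ↔ x ∈ a ∧ R x y := by
  -- The hypothesis on `R` concerns variables `0` and `1` only; under quantifiers, instance search
  -- needs it at arbitrary definable terms.
  have inst : ∀ (t s : (ℕ → M) → M) [DfnTerm t] [DfnTerm s], Dfn fun v => R (t v) (s v) :=
    fun t s => h.subst₂ t s
  obtain ⟨f, hf⟩ := exists_repl a (fun x p => ∃ y, p = opair x y ∧ R x y) (by
    rintro x hx _ _ ⟨y, rfl, hy⟩ ⟨y', rfl, hy'⟩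
    rw [hR x hx y y' hy hy'])
  have key : ∀ x y, Maps f x y ↔ x ∈ a ∧ R x y := by
    intro x y
    rw [maps_iff, hf]
    constructor
    · rintro ⟨x', hx', y', e, hr⟩
      obtain ⟨rfl, rfl⟩ := opair_inj.1 e
      exact ⟨hx', hr⟩
    · rintro ⟨hx, hr⟩
      exact ⟨x, hx, y, rfl, hr⟩
  refine ⟨f, ⟨fun p hp => ?_, fun x y y' h1 h2 => ?_⟩, key⟩
  · obtain ⟨x, -, y, e, -⟩ := (hf p).1 hp
    exact ⟨x, y, isPair_iff.2 e⟩
  · rw [key] at h1 h2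
    exact hR x h1.1 y y' h1.2 h2.2

theorem exists_prod (a b : M) : ∃ c : M, ∀ p, p ∈ c ↔ ∃ x y, x ∈ a ∧ y ∈ b ∧ p = opair x y := by
  have h1 : ∀ x, ∃ s : M, ∀ p, p ∈ s ↔ ∃ y, y ∈ b ∧ p = opair x y := fun x =>
    exists_repl b (fun y p => p = opair x y) fun _ _ _ _ h h' => h.trans h'.symm
  obtain ⟨s, hs⟩ := exists_repl a (fun x s => ∀ p, p ∈ s ↔ ∃ y, y ∈ b ∧ p = opair x y)
    fun _ _ _ _ h h' => ext fun p => (h p).trans (h' p).symm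
  obtain ⟨u, hu⟩ := hM.out.union s
  refine ⟨u, fun p => (hu p).trans ⟨?_, ?_⟩⟩
  · rintro ⟨t, ht, hp⟩
    obtain ⟨x, hx, h⟩ := (hs t).1 ht
    obtain ⟨y, hy, e⟩ := (h p).1 hp
    exact ⟨x, y, hx, hy, e⟩
  · rintro ⟨x, y, hx, hy, e⟩
    obtain ⟨t, ht⟩ := h1 x
    exact ⟨t, (hs t).2 ⟨x, hx, ht⟩, (ht p).2 ⟨y, hy, e⟩⟩

theorem IsFunction.ext {f g : M} (hf : IsFunction f) (hg : IsFunction g)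
    (h : ∀ x y, Maps f x y ↔ Maps g x y) : f = g := by
  refine SetModel.ext fun p => ⟨fun hp => ?_, fun hp => ?_⟩
  · obtain ⟨x, y, e⟩ := hf.1 p hp
    rw [isPair_iff.1 e, ← maps_iff, ← h, maps_iff, ← isPair_iff.1 e]
    exact hp
  · obtain ⟨x, y, e⟩ := hg.1 p hp
    rw [isPair_iff.1 e, ← maps_iff, h, maps_iff, ← isPair_iff.1 e]
    exact hp

theorem Maps.mono {f g x y : M} (h : Maps f x y) (hfg : Sub f g) : Maps g x y :=
  maps_iff.2 (hfg _ (maps_iff.1 h))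

/-! ### Ordinals -/

theorem mem_irrefl (x : M) : ¬ x ∈ x := fun h => by
  obtain ⟨s, hs⟩ := hM.out.pairing x x
  obtain ⟨y, hy, hy'⟩ := hM.out.foundation s ⟨x, (hs x).2 (Or.inl rfl)⟩
  obtain rfl : y = x := by simpa using (hs y).1 hy
  exact hy' y hy h

theorem mem_asymm {x y : M} (h : x ∈ y) : ¬ y ∈ x := fun h' => by
  obtain ⟨s, hs⟩ := hM.out.pairing x y
  obtain ⟨z, hz, hz'⟩ := hM.out.foundation s ⟨x, (hs x).2 (Or.inl rfl)⟩
  rcases (hs z).1 hz with rfl | rfl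
  · exact hz' y ((hs y).2 (Or.inr rfl)) h'
  · exact hz' x ((hs x).2 (Or.inl rfl)) h

theorem mem_no_cycle {x y z : M} (h : x ∈ y) (h' : y ∈ z) : ¬ z ∈ x := fun h'' => by
  obtain ⟨s, hs⟩ := hM.out.pairing x y
  obtain ⟨t, ht⟩ := exists_insert s z
  have hx : x ∈ t := (ht x).2 (Or.inl ((hs x).2 (Or.inl rfl)))
  have hy : y ∈ t := (ht y).2 (Or.inl ((hs y).2 (Or.inr rfl)))
  have hz : z ∈ t := (ht z).2 (Or.inr rfl)
  obtain ⟨w, hw, hw'⟩ := hM.out.foundation t ⟨x, hx⟩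
  rcases (ht w).1 hw with h1 | rfl
  · rcases (hs w).1 h1 with rfl | rfl
    · exact hw' z hz h''
    · exact hw' x hx h
  · exact hw' y hy h'

theorem IsOrdinal.trans {a b c : M} (hc : IsOrdinal c) (h : a ∈ b) (h' : b ∈ c) : a ∈ c :=
  hc.1 b h' a h

theorem IsOrdinal.mem {a x : M} (ha : IsOrdinal a) (hx : x ∈ a) : IsOrdinal x := by
  refine ⟨fun y hy z hz => ?_, fun y z hy hz => ha.2 y z (ha.trans hy hx) (ha.trans hz hx)⟩
  have hya := ha.trans hy hx
  rcases ha.2 z x (ha.trans hz hya) hx with h | rfl | h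
  · exact h
  · exact (mem_asymm hy hz).elim
  · exact (mem_no_cycle hz hy h).elim

/-- An `∈`-minimal element of `a \ c` has exactly the elements of `c`, so it equals `c`. -/
theorem IsOrdinal.mem_of_ssub {a c : M} (ha : IsOrdinal a) (hc : ∀ x, x ∈ c → Sub x c)
    (h : Sub c a) (hne : c ≠ a) : c ∈ a := by
  obtain ⟨d, hd⟩ := exists_sep a (fun x => ¬ x ∈ c)
  have hdn : ∃ y, y ∈ d := by
    by_contra! hcon
    refine hne (ext fun z => ⟨h z, fun hz => ?_⟩)
    by_contra hzc
    exact hcon z ((hd z).2 ⟨hz, hzc⟩)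
  obtain ⟨m, hm, hm'⟩ := hM.out.foundation d hdn
  obtain ⟨hma, hmc⟩ := (hd m).1 hm
  have : c = m := by
    refine ext fun z => ⟨fun hz => ?_, fun hz => ?_⟩
    · rcases ha.2 z m (h z hz) hma with h1 | rfl | h1
      · exact h1
      · exact (hmc hz).elim
      · exact (hmc (hc z hz m h1)).elim
    · by_contra hzc
      exact hm' z ((hd z).2 ⟨ha.trans hz hma, hzc⟩) hz
  exact this ▸ hma

/-- The intersection of `a` and `b` is transitive; were it different from both, it would belong to
both and hence to itself. -/
theorem IsOrdinal.trichotomy {a b : M} (ha : IsOrdinal a) (hb : IsOrdinal b) :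
    a ∈ b ∨ a = b ∨ b ∈ a := by
  obtain ⟨c, hc⟩ := exists_sep a (fun x => x ∈ b)
  have hct : ∀ x, x ∈ c → Sub x c := fun x hx y hy =>
    (hc y).2 ⟨ha.trans hy ((hc x).1 hx).1, hb.trans hy ((hc x).1 hx).2⟩
  have hca : Sub c a := fun x hx => ((hc x).1 hx).1
  have hcb : Sub c b := fun x hx => ((hc x).1 hx).2
  by_cases h1 : c = a
  · by_cases h2 : c = b
    · exact Or.inr (Or.inl (h1.symm.trans h2))
    · exact Or.inl (h1 ▸ hb.mem_of_ssub hct hcb h2)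
  · by_cases h2 : c = b
    · exact Or.inr (Or.inr (h2 ▸ ha.mem_of_ssub hct hca h1))
    · have := (hc c).2 ⟨ha.mem_of_ssub hct hca h1, hb.mem_of_ssub hct hcb h2⟩
      exact (mem_irrefl c this).elim

theorem OrdLe.refl (a : M) : OrdLe a a := Or.inl rfl

theorem IsOrdinal.le_or_lt {a b : M} (ha : IsOrdinal a) (hb : IsOrdinal b) :
    OrdLe a b ∨ b ∈ a := by
  rcases ha.trichotomy hb with h | h | h
  exacts [Or.inl (Or.inr h), Or.inl (Or.inl h), Or.inr h]

theorem OrdLe.not_lt {a b : M} (h : OrdLe a b) : ¬ b ∈ a := by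
  rcases h with rfl | h
  exacts [mem_irrefl a, mem_asymm h]

theorem OrdLe.trans_lt {a b c : M} (h : OrdLe a b) (h' : b ∈ c) (hc : IsOrdinal c) : a ∈ c := by
  rcases h with rfl | h
  exacts [h', hc.trans h h']

theorem OrdLe.lt_trans {a b c : M} (h : a ∈ b) (h' : OrdLe b c) (hc : IsOrdinal c) : a ∈ c := by
  rcases h' with rfl | h'
  exacts [h, hc.trans h h']

theorem OrdLe.trans {a b c : M} (h : OrdLe a b) (h' : OrdLe b c) (hc : IsOrdinal c) :
    OrdLe a c := by
  rcases h with rfl | h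
  exacts [h', Or.inr (OrdLe.lt_trans h h' hc)]

theorem OrdLe.antisymm {a b : M} (h : OrdLe a b) (h' : OrdLe b a) : a = b := by
  rcases h with rfl | h
  exacts [rfl, (h'.not_lt h).elim]

theorem IsOrdinal.le_iff_sub {a b : M} (ha : IsOrdinal a) (hb : IsOrdinal b) :
    OrdLe a b ↔ Sub a b := by
  refine ⟨fun h x hx => OrdLe.lt_trans hx h hb, fun h => ?_⟩
  exact (ha.le_or_lt hb).resolve_right fun h' => mem_irrefl b (h b h')

theorem isOrdinal_of_transitive {a : M} (h : ∀ x, x ∈ a → IsOrdinal x)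
    (h' : ∀ x, x ∈ a → Sub x a) : IsOrdinal a :=
  ⟨h', fun x y hx hy => (h x hx).trichotomy (h y hy)⟩

theorem exists_least (P : M → Prop) [h : Dfn fun v => P (v 0)] {a : M} (ha : IsOrdinal a)
    (hP : P a) : ∃ b, IsOrdinal b ∧ OrdLe b a ∧ P b ∧ ∀ c, c ∈ b → ¬ P c := by
  obtain ⟨s, hs⟩ := exists_sep a P
  by_cases hne : ∃ y, y ∈ s
  · obtain ⟨b, hb, hb'⟩ := hM.out.foundation s hne
    rw [hs] at hb
    exact ⟨b, ha.mem hb.1, Or.inr hb.1, hb.2, fun c hc hPc =>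
      hb' c ((hs c).2 ⟨ha.trans hc hb.1, hPc⟩) hc⟩
  · exact ⟨a, ha, OrdLe.refl a, hP, fun c hc hPc => hne ⟨c, (hs c).2 ⟨hc, hPc⟩⟩⟩

theorem ordinal_induction (P : M → Prop) [h : Dfn fun v => P (v 0)]
    (ih : ∀ a, IsOrdinal a → (∀ b, b ∈ a → P b) → P a) {a : M} (ha : IsOrdinal a) : P a := by
  by_contra hP
  have inst : ∀ (t : (ℕ → M) → M) [DfnTerm t], Dfn fun v => P (t v) := fun t => h.subst₁ t
  obtain ⟨b, hb, -, hPb, hlt⟩ := exists_least (fun x : M => ¬ P x) ha hP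
  exact hPb (ih b hb fun c hc => not_not.1 (hlt c hc))

theorem exists_succ {a : M} (ha : IsOrdinal a) : ∃ b, IsOrdinal b ∧ IsSucc b a := by
  obtain ⟨b, hb⟩ := exists_insert a a
  refine ⟨b, isOrdinal_of_transitive (fun x hx => ?_) (fun x hx y hy => ?_), hb⟩
  · rcases (hb x).1 hx with h | rfl
    exacts [ha.mem h, ha]
  · rcases (hb x).1 hx with h | rfl
    exacts [(hb y).2 (Or.inl (ha.trans hy h)), (hb y).2 (Or.inl hy)]

theorem exists_union_isOrdinal {s : M} (h : ∀ x, x ∈ s → IsOrdinal x) :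
    ∃ u : M, IsOrdinal u ∧ ∀ z, z ∈ u ↔ ∃ y, y ∈ s ∧ z ∈ y := by
  obtain ⟨u, hu⟩ := hM.out.union s
  refine ⟨u, isOrdinal_of_transitive (fun x hx => ?_) (fun x hx y hy => ?_), hu⟩
  · obtain ⟨y, hy, hx⟩ := (hu x).1 hx
    exact (h y hy).mem hx
  · obtain ⟨z, hz, hx⟩ := (hu x).1 hx
    exact (hu y).2 ⟨z, hz, (h z hz).trans hy hx⟩

end Sets

/-! ### Order types, injections into ordinals, and cofinality -/

section OrderTypes

variable {M : Type*} [Membership M M] [hM : Fact (IsModelZF M)]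

/-- The relation `R` well-orders the set `r`. -/
structure WellOrders (R : M → M → Prop) (r : M) : Prop where
  irrefl : ∀ x, x ∈ r → ¬ R x x
  trans : ∀ x y z, x ∈ r → y ∈ r → z ∈ r → R x y → R y z → R x z
  total : ∀ x y, x ∈ r → y ∈ r → R x y ∨ x = y ∨ R y x
  wf : ∀ s, Sub s r → (∃ y, y ∈ s) → ∃ y, y ∈ s ∧ ∀ z, z ∈ s → ¬ R z y

theorem WellOrders.mono {R : M → M → Prop} {r s : M} (h : WellOrders R r) (hs : Sub s r) :
    WellOrders R s :=
  ⟨fun x hx => h.irrefl x (hs x hx),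
    fun x y z hx hy hz => h.trans x y z (hs x hx) (hs y hy) (hs z hz),
    fun x y hx hy => h.total x y (hs x hx) (hs y hy),
    fun t ht => h.wf t fun x hx => hs x (ht x hx)⟩

/-- There is an `R`-increasing function from the ordinal `a` onto `s`. -/
def RelType (R : M → M → Prop) (s a : M) : Prop :=
  IsOrdinal a ∧ ∃ g, IsFunction g ∧ IsDomain g a ∧ IsRange g s ∧
    ∀ b c y z, b ∈ c → Maps g b y → Maps g c z → R y z

/-- By induction the two enumerations agree throughout `a`: at the first disagreement, one of them
would have skipped an element of `s` for good. -/
theorem sub_of_increasing {R : M → M → Prop} {s a a' g g' : M} (hR : WellOrders R s)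
    (ha : IsOrdinal a) (hg : IsFunction g) (hga : IsDomain g a) (hgs : IsRange g s)
    (hgi : ∀ b c y z, b ∈ c → Maps g b y → Maps g c z → R y z)
    (ha' : IsOrdinal a') (hg' : IsFunction g') (hga' : IsDomain g' a') (hgs' : IsRange g' s)
    (hgi' : ∀ b c y z, b ∈ c → Maps g' b y → Maps g' c z → R y z) : Sub a a' := by
  have key : ∀ b, b ∈ a → ∀ y, Maps g b y → Maps g' b y := by
    intro b hb
    refine ordinal_induction (fun b => ∀ y, Maps g b y → Maps g' b y) ?_ (ha.mem hb)
    intro b hbo ih y hy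
    have hba : b ∈ a := (hga b).2 ⟨y, hy⟩
    have hys : y ∈ s := (hgs y).2 ⟨b, hy⟩
    obtain ⟨b', hb'⟩ := (hgs' y).1 hys
    have hba' : b' ∈ a' := (hga' b').2 ⟨y, hb'⟩
    rcases hbo.trichotomy (ha'.mem hba') with h | rfl | h
    · obtain ⟨z, hz⟩ := (hga' b).1 (ha'.trans h hba')
      have hzs : z ∈ s := (hgs' z).2 ⟨b, hz⟩
      have hzy : R z y := hgi' b b' z y h hz hb'
      obtain ⟨c, hc⟩ := (hgs z).1 hzs
      rcases hbo.trichotomy (ha.mem ((hga c).2 ⟨z, hc⟩)) with h' | rfl | h'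
      · exact (hR.irrefl y hys (hR.trans y z y hys hzs hys (hgi b c y z h' hy hc) hzy)).elim
      · rw [hg.2 b z y hc hy] at hzy
        exact (hR.irrefl y hys hzy).elim
      · exact (hR.irrefl z hzs (hgi' c b z z h' (ih c h' z hc) hz)).elim
    · exact hb'
    · obtain ⟨z, hz⟩ := (hga b').1 (ha.trans h hba)
      rw [hg'.2 b' z y (ih b' h z hz) hb'] at hz
      exact (hR.irrefl y hys (hgi b' b y y h hz hy)).elim
  intro b hb
  obtain ⟨y, hy⟩ := (hga b).1 hb
  exact (hga' b).2 ⟨y, key b hb y hy⟩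

theorem RelType.unique {R : M → M → Prop} {s a a' : M} (hR : WellOrders R s)
    (h : RelType R s a) (h' : RelType R s a') : a = a' := by
  obtain ⟨ha, g, hg, hga, hgs, hgi⟩ := h
  obtain ⟨ha', g', hg', hga', hgs', hgi'⟩ := h'
  have h1 := sub_of_increasing hR ha hg hga hgs hgi ha' hg' hga' hgs' hgi'
  have h2 := sub_of_increasing hR ha' hg' hga' hgs' hgi' ha hg hga hgs hgi
  exact ext fun z => ⟨h1 z, h2 z⟩

/-- The initial segment of `s` below the `b`-th element has type `b`. -/
theorem relType_segment {R : M → M → Prop} {s a g b y t : M} (hR : WellOrders R s)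
    (ha : IsOrdinal a) (hg : IsFunction g) (hga : IsDomain g a) (hgs : IsRange g s)
    (hgi : ∀ b c y z, b ∈ c → Maps g b y → Maps g c z → R y z) (hby : Maps g b y)
    (ht : ∀ z, z ∈ t ↔ z ∈ s ∧ R z y) : RelType R t b := by
  have hba : b ∈ a := (hga b).2 ⟨y, hby⟩
  have hys : y ∈ s := (hgs y).2 ⟨b, hby⟩
  obtain ⟨g', hg', hm⟩ := exists_function b (fun x y => Maps g x y)
    fun x _ y y' h h' => hg.2 x y y' h h'
  refine ⟨ha.mem hba, g', hg', fun x => ⟨fun hx => ?_, ?_⟩, fun z => ⟨fun hz => ?_, ?_⟩, ?_⟩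
  · obtain ⟨z, hz⟩ := (hga x).1 (ha.trans hx hba)
    exact ⟨z, (hm x z).2 ⟨hx, hz⟩⟩
  · rintro ⟨z, hz⟩
    exact ((hm x z).1 hz).1
  · obtain ⟨hzs, hzy⟩ := (ht z).1 hz
    obtain ⟨x, hx⟩ := (hgs z).1 hzs
    refine ⟨x, (hm x z).2 ⟨?_, hx⟩⟩
    rcases (ha.mem ((hga x).2 ⟨z, hx⟩)).trichotomy (ha.mem hba) with h | rfl | h
    · exact h
    · rw [hg.2 x z y hx hby] at hzy
      exact (hR.irrefl y hys hzy).elim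
    · exact (hR.irrefl y hys (hR.trans y z y hys hzs hys (hgi b x y z h hby hx) hzy)).elim
  · rintro ⟨x, hx⟩
    obtain ⟨hxb, hx⟩ := (hm x z).1 hx
    exact (ht z).2 ⟨(hgs z).2 ⟨x, hx⟩, hgi x b z y hxb hx hby⟩
  · intro c d z w hcd hc hd
    exact hgi c d z w hcd ((hm _ _).1 hc).2 ((hm _ _).1 hd).2

/-- The type is the set `N` of the types of the proper initial segments. By `hA` it is transitive,
and by `hB` longer segments have larger types, so inverting `Q` gives the enumeration. Uniqueness of
types is what permits replacement. -/
theorem exists_relType_of_segments (R : M → M → Prop) [h : Dfn fun v => R (v 0) (v 1)] {s : M}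
    (hR : WellOrders R s)
    (hs : ∀ y, y ∈ s → ∃ t, (∀ z, z ∈ t ↔ z ∈ s ∧ R z y) ∧ ∃ a, RelType R t a) :
    ∃ a, RelType R s a := by
  have inst : ∀ (t s : (ℕ → M) → M) [DfnTerm t] [DfnTerm s], Dfn fun v => R (t v) (s v) :=
    fun t s => h.subst₂ t s
  have inst' : ∀ (t s : (ℕ → M) → M) [DfnTerm t] [DfnTerm s], Dfn fun v => RelType R (t v) (s v) :=
    fun t s _ _ => by unfold RelType; infer_instance
  set Q : M → M → Prop := fun y a => ∃ t, (∀ z, z ∈ t ↔ z ∈ s ∧ R z y) ∧ RelType R t a with hQ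
  have instQ : ∀ (t s : (ℕ → M) → M) [DfnTerm t] [DfnTerm s], Dfn fun v => Q (t v) (s v) :=
    fun t s _ _ => by rw [hQ]; infer_instance
  have hQu : ∀ y a a', Q y a → Q y a' → a = a' := by
    rintro y a a' ⟨t, ht, h1⟩ ⟨t', ht', h2⟩
    obtain rfl : t = t' := ext fun z => (ht z).trans (ht' z).symm
    exact h1.unique (hR.mono fun z hz => ((ht z).1 hz).1) h2
  have hQo : ∀ y a, Q y a → IsOrdinal a := fun y a ⟨_, _, h⟩ => h.1
  have hseg : ∀ t y a g b z, y ∈ s → (∀ z, z ∈ t ↔ z ∈ s ∧ R z y) → IsOrdinal a →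
      IsFunction g → IsDomain g a → IsRange g t →
      (∀ b c y z, b ∈ c → Maps g b y → Maps g c z → R y z) → Maps g b z → Q z b := by
    intro t y a g b z hy ht ha hg hga hgt hgi hbz
    have hzt : z ∈ t := (hgt z).2 ⟨b, hbz⟩
    obtain ⟨u, hu⟩ := exists_sep t (fun x => R x z)
    refine ⟨u, fun x => ?_, relType_segment (hR.mono fun z hz => ((ht z).1 hz).1)
      ha hg hga hgt hgi hbz hu⟩
    rw [hu, ht]
    refine ⟨fun h => ⟨h.1.1, h.2⟩, fun h => ⟨⟨h.1, ?_⟩, h.2⟩⟩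
    exact hR.trans x z y h.1 ((ht z).1 hzt).1 hy h.2 ((ht z).1 hzt).2
  have hA : ∀ y a b, y ∈ s → Q y a → b ∈ a → ∃ z, z ∈ s ∧ Q z b := by
    rintro y a b hy ⟨t, ht, ha, g, hg, hga, hgt, hgi⟩ hb
    obtain ⟨z, hz⟩ := (hga b).1 hb
    exact ⟨z, ((ht z).1 ((hgt z).2 ⟨b, hz⟩)).1, hseg t y a g b z hy ht ha hg hga hgt hgi hz⟩
  have hB : ∀ y z a b, y ∈ s → z ∈ s → R y z → Q y a → Q z b → a ∈ b := by
    rintro y z a b hy hz hyz hya ⟨t, ht, hb, g, hg, hgb, hgt, hgi⟩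
    obtain ⟨c, hc⟩ := (hgt y).1 ((ht y).2 ⟨hy, hyz⟩)
    rw [hQu y a c hya (hseg t z b g c y hz ht hb hg hgb hgt hgi hc)]
    exact (hgb c).2 ⟨y, hc⟩
  obtain ⟨N, hN⟩ := exists_repl s Q fun y _ a a' => hQu y a a'
  obtain ⟨g, hg, hm⟩ := exists_function N (fun a y => y ∈ s ∧ Q y a) (by
    rintro a - y y' ⟨hy, hya⟩ ⟨hy', hya'⟩
    rcases hR.total y y' hy hy' with h | h | h
    · exact (mem_irrefl a (hB y y' a a hy hy' h hya hya')).elim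
    · exact h
    · exact (mem_irrefl a (hB y' y a a hy' hy h hya' hya)).elim)
  refine ⟨N, isOrdinal_of_transitive (fun a ha => ?_) (fun a ha b hb => ?_), g, hg,
    fun a => ⟨fun ha => ?_, ?_⟩, fun y => ⟨fun hy => ?_, ?_⟩, ?_⟩
  · obtain ⟨y, -, hya⟩ := (hN a).1 ha
    exact hQo y a hya
  · obtain ⟨y, hy, hya⟩ := (hN a).1 ha
    obtain ⟨z, hz, hzb⟩ := hA y a b hy hya hb
    exact (hN b).2 ⟨z, hz, hzb⟩
  · obtain ⟨y, hy⟩ := (hN a).1 ha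
    exact ⟨y, (hm a y).2 ⟨ha, hy⟩⟩
  · rintro ⟨y, hy⟩
    exact ((hm a y).1 hy).1
  · obtain ⟨t, ht, a, ha⟩ := hs y hy
    exact ⟨a, (hm a y).2 ⟨(hN a).2 ⟨y, hy, t, ht, ha⟩, hy, t, ht, ha⟩⟩
  · rintro ⟨a, ha⟩
    exact ((hm a y).1 ha).2.1
  · intro b c y z hbc hby hcz
    obtain ⟨-, hy, hyb⟩ := (hm b y).1 hby
    obtain ⟨-, hz, hzc⟩ := (hm c z).1 hcz
    rcases hR.total y z hy hz with h | rfl | h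
    · exact h
    · rw [hQu y b c hyb hzc] at hbc
      exact (mem_irrefl c hbc).elim
    · exact (mem_asymm hbc (hB z y c b hz hy h hzc hyb)).elim

/-- All initial segments have types: below a minimal `y` whose segment has none, every shorter
segment has one, and then so does the segment of `y`. -/
theorem exists_relType (R : M → M → Prop) [h : Dfn fun v => R (v 0) (v 1)] {r : M}
    (hR : WellOrders R r) : ∃ a, RelType R r a := by
  have inst : ∀ (t s : (ℕ → M) → M) [DfnTerm t] [DfnTerm s], Dfn fun v => R (t v) (s v) :=
    fun t s => h.subst₂ t s
  have inst' : ∀ (t s : (ℕ → M) → M) [DfnTerm t] [DfnTerm s], Dfn fun v => RelType R (t v) (s v) :=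
    fun t s _ _ => by unfold RelType; infer_instance
  refine exists_relType_of_segments R hR ?_
  by_contra! hcon
  obtain ⟨y₀, hy₀, hy₀'⟩ := hcon
  obtain ⟨b, hb⟩ := exists_sep r
    (fun y => ¬ ∃ t, (∀ z, z ∈ t ↔ z ∈ r ∧ R z y) ∧ ∃ a, RelType R t a)
  obtain ⟨y, hy, hmin⟩ := hR.wf b (fun y hy => ((hb y).1 hy).1) ⟨y₀, (hb y₀).2 ⟨hy₀, by
    rintro ⟨t, ht, a, ha⟩
    exact hy₀' t ht a ha⟩⟩
  obtain ⟨hyr, hy⟩ := (hb y).1 hy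
  obtain ⟨t, ht⟩ := exists_sep r (fun z => R z y)
  have htr : Sub t r := fun z hz => ((ht z).1 hz).1
  refine hy ⟨t, ht, exists_relType_of_segments R (hR.mono htr) fun z hz => ?_⟩
  have hzr := htr z hz
  have hzy := ((ht z).1 hz).2
  have hzb : ¬ z ∈ b := fun h => hmin z h hzy
  obtain ⟨u, hu, hua⟩ := not_not.1 fun h => hzb ((hb z).2 ⟨hzr, h⟩)
  refine ⟨u, fun x => ?_, hua⟩
  rw [hu, ht]
  exact ⟨fun h => ⟨⟨h.1, hR.trans x z y h.1 hzr hyr h.2 hzy⟩, h.2⟩, fun h => ⟨h.1.1, h.2⟩⟩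

theorem wellOrders_mem {s : M} (h : ∀ x, x ∈ s → IsOrdinal x) :
    WellOrders (fun x y => x ∈ y) s where
  irrefl x _ := mem_irrefl x
  trans _ _ z _ _ hz hxy hyz := (h z hz).trans hxy hyz
  total x y hx hy := (h x hx).trichotomy (h y hy)
  wf t _ hne := hM.out.foundation t hne

theorem exists_hasOrderType {s : M} (h : ∀ x, x ∈ s → IsOrdinal x) : ∃ a, HasOrderType s a :=
  exists_relType (fun x y => x ∈ y) (wellOrders_mem h)

/-! ### Injections -/

/-- There is an injection from `r` to `i`. -/
def Inj (r i : M) : Prop :=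
  ∃ h, IsFunction h ∧ (∀ x, x ∈ r → ∃ y, y ∈ i ∧ Maps h x y) ∧
    ∀ x x' y, x ∈ r → x' ∈ r → Maps h x y → Maps h x' y → x = x'

/-- No choice is needed, as the target is an ordinal: each `x` is sent to the least `y` related to
it. -/
theorem Inj.of_rel {r i : M} (hi : IsOrdinal i) (R : M → M → Prop)
    [h : Dfn fun v => R (v 0) (v 1)] (h1 : ∀ x, x ∈ r → ∃ y, y ∈ i ∧ R x y)
    (h2 : ∀ x x' y, x ∈ r → x' ∈ r → y ∈ i → R x y → R x' y → x = x') : Inj r i := by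
  have inst : ∀ (t s : (ℕ → M) → M) [DfnTerm t] [DfnTerm s], Dfn fun v => R (t v) (s v) :=
    fun t s => h.subst₂ t s
  obtain ⟨f, hf, hm⟩ := exists_function r
    (fun x y => (y ∈ i ∧ R x y) ∧ ∀ z, z ∈ y → ¬ R x z) (by
      rintro x - y y' ⟨⟨hy, hxy⟩, hl⟩ ⟨⟨hy', hxy'⟩, hl'⟩
      rcases (hi.mem hy).trichotomy (hi.mem hy') with h | h | h
      exacts [(hl' y h hxy).elim, h, (hl y' h hxy').elim])
  refine ⟨f, hf, fun x hx => ?_, fun x x' y hx hx' hy hy' => ?_⟩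
  · obtain ⟨y, hy, hxy⟩ := h1 x hx
    obtain ⟨b, -, -, hb, hbl⟩ := exists_least (fun y => y ∈ i ∧ R x y) (hi.mem hy) ⟨hy, hxy⟩
    exact ⟨b, hb.1, (hm x b).2 ⟨hx, hb, fun z hz hxz => hbl z hz ⟨hi.trans hz hb.1, hxz⟩⟩⟩
  · have e1 := ((hm x y).1 hy).2.1
    have e2 := ((hm x' y).1 hy').2.1
    exact h2 x x' y hx hx' e1.1 e1.2 e2.2

theorem Inj.mono {r r' i : M} (h : Inj r' i) (hr : Sub r r') : Inj r i := by
  obtain ⟨f, hf, h1, h2⟩ := h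
  exact ⟨f, hf, fun x hx => h1 x (hr x hx), fun x x' y hx hx' => h2 x x' y (hr x hx) (hr x' hx')⟩

theorem Inj.mono_right {r i i' : M} (h : Inj r i) (hi : Sub i i') : Inj r i' := by
  obtain ⟨f, hf, h1, h2⟩ := h
  refine ⟨f, hf, fun x hx => ?_, h2⟩
  obtain ⟨y, hy, hxy⟩ := h1 x hx
  exact ⟨y, hi y hy, hxy⟩

theorem Inj.trans {r i j : M} (h : Inj r i) (h' : Inj i j) (hj : IsOrdinal j) : Inj r j := by
  obtain ⟨f, hf, h1, h2⟩ := h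
  obtain ⟨g, hg, h3, h4⟩ := h'
  refine Inj.of_rel hj (fun x z => ∃ y, y ∈ i ∧ Maps f x y ∧ Maps g y z) (fun x hx => ?_) ?_
  · obtain ⟨y, hy, hxy⟩ := h1 x hx
    obtain ⟨z, hz, hyz⟩ := h3 y hy
    exact ⟨z, hz, y, hy, hxy, hyz⟩
  · rintro x x' z hx hx' - ⟨y, hy, hxy, hyz⟩ ⟨y', hy', hxy', hyz'⟩
    obtain rfl := h4 y y' z hy hy' hyz hyz'
    exact h2 x x' y hx hx' hxy hxy'

theorem inj_of_sub {i j : M} (hj : IsOrdinal j) (h : Sub i j) : Inj i j :=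
  Inj.of_rel hj (fun x y => x = y) (fun x hx => ⟨x, h x hx, rfl⟩) fun _ _ _ _ _ _ h h' =>
    h.trans h'.symm

theorem increasing_injective {R : M → M → Prop} {s a g : M} (hR : WellOrders R s)
    (ha : IsOrdinal a) (hga : IsDomain g a) (hgs : IsRange g s)
    (hgi : ∀ b c y z, b ∈ c → Maps g b y → Maps g c z → R y z) {b c y : M}
    (hb : Maps g b y) (hc : Maps g c y) : b = c := by
  have hy := (hgs y).2 ⟨b, hb⟩
  rcases (ha.mem ((hga b).2 ⟨y, hb⟩)).trichotomy (ha.mem ((hga c).2 ⟨y, hc⟩)) with h | h | h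
  · exact (hR.irrefl y hy (hgi b c y y h hb hc)).elim
  · exact h
  · exact (hR.irrefl y hy (hgi c b y y h hc hb)).elim

theorem RelType.inj {R : M → M → Prop} {s a : M} (h : RelType R s a) : Inj s a := by
  obtain ⟨ha, g, hg, hga, hgs, hgi⟩ := h
  refine Inj.of_rel ha (fun x b => Maps g b x) (fun x hx => ?_) fun x x' b _ _ _ h h' =>
    hg.2 b x x' h h'
  obtain ⟨b, hb⟩ := (hgs x).1 hx
  exact ⟨b, (hga b).2 ⟨x, hb⟩, hb⟩

theorem RelType.inj' {R : M → M → Prop} {s a : M} (hR : WellOrders R s) (h : RelType R s a) :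
    Inj a s := by
  obtain ⟨ha, g, hg, hga, hgs, hgi⟩ := h
  refine ⟨g, hg, fun b hb => ?_, fun b c y _ _ hb hc => increasing_injective hR ha hga hgs hgi hb hc⟩
  obtain ⟨y, hy⟩ := (hga b).1 hb
  exact ⟨y, (hgs y).2 ⟨b, hy⟩, hy⟩

theorem HasOrderType.inj {s a : M} (h : HasOrderType s a) : Inj s a := RelType.inj h

theorem HasOrderType.inj' {s a : M} (hs : ∀ x, x ∈ s → IsOrdinal x) (h : HasOrderType s a) :
    Inj a s := RelType.inj' (wellOrders_mem hs) h

/-- An increasing function on ordinals satisfies `g(b) ≥ b`, so a value at `k` could not lie in `k`.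
-/
theorem HasOrderType.le_of_sub {s a k : M} (hk : IsOrdinal k) (hs : Sub s k)
    (h : HasOrderType s a) : OrdLe a k := by
  obtain ⟨ha, g, hg, hga, hgs, hgi⟩ := h
  refine (ha.le_or_lt hk).resolve_right fun hka => ?_
  have key : ∀ y, Maps g k y → OrdLe k y := by
    refine ordinal_induction (fun b => ∀ y, Maps g b y → OrdLe b y) (fun b hb ih y hy => ?_) hk
    have hyo : IsOrdinal y := hk.mem (hs y ((hgs y).2 ⟨b, hy⟩))
    refine (hb.le_or_lt hyo).resolve_right fun hyb => ?_
    obtain ⟨z, hz⟩ := (hga y).1 (ha.trans hyb ((hga b).2 ⟨y, hy⟩))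
    exact (ih y hyb z hz).not_lt (hgi y b z y hyb hz hy)
  obtain ⟨y, hy⟩ := (hga k).1 hka
  exact (key y hy).not_lt (hs y ((hgs y).2 ⟨k, hy⟩))

/-- The image of `m` under such an injection is a subset of `k`, of some type `n ≤ k < m`.
Enumerating it and inverting the injection is a bijection from `n` to `m`, although `m` is initial.
-/
theorem IsCardinal.not_inj {m k a : M} (hm : IsCardinal m) (hk : k ∈ m) (ha : IsOrdinal a)
    (hma : OrdLe m a) : ¬ Inj a k := fun hinj => by
  have hko := hm.1.mem hk
  obtain ⟨f, hf, h1, h2⟩ := hinj.mono ((hm.1.le_iff_sub ha).1 hma)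
  obtain ⟨s, hs⟩ := exists_sep k (fun y => ∃ x, x ∈ m ∧ Maps f x y)
  have hsk : Sub s k := fun y hy => ((hs y).1 hy).1
  have hso : ∀ y, y ∈ s → IsOrdinal y := fun y hy => hko.mem (hsk y hy)
  obtain ⟨n, hn⟩ := exists_hasOrderType hso
  have hnm : n ∈ m := OrdLe.trans_lt (hn.le_of_sub hko hsk) hk hm.1
  obtain ⟨hno, g, hg, hgn, hgs, hgi⟩ := hn
  obtain ⟨e, he, hem⟩ := exists_function n (fun b x => x ∈ m ∧ ∃ y, Maps g b y ∧ Maps f x y) (by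
    rintro b - x x' ⟨hx, y, hby, hxy⟩ ⟨hx', y', hby', hxy'⟩
    rw [← hg.2 b y y' hby hby'] at hxy'
    exact h2 x x' y hx hx' hxy hxy')
  refine hm.2 n hnm ⟨e, he, fun b => ⟨fun hb => ?_, ?_⟩, fun x => ⟨fun hx => ?_, ?_⟩, ?_⟩
  · obtain ⟨y, hy⟩ := (hgn b).1 hb
    obtain ⟨-, x, hx, hxy⟩ := (hs y).1 ((hgs y).2 ⟨b, hy⟩)
    exact ⟨x, (hem b x).2 ⟨hb, hx, y, hy, hxy⟩⟩
  · rintro ⟨x, hx⟩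
    exact ((hem b x).1 hx).1
  · obtain ⟨y, hy, hxy⟩ := h1 x hx
    obtain ⟨b, hb⟩ := (hgs y).1 ((hs y).2 ⟨hy, x, hx, hxy⟩)
    exact ⟨b, (hem b x).2 ⟨(hgn b).2 ⟨y, hb⟩, hx, y, hb, hxy⟩⟩
  · rintro ⟨b, hb⟩
    exact ((hem b x).1 hb).2.1
  · intro b c x hb hc
    obtain ⟨-, hx, y, hby, hxy⟩ := (hem b x).1 hb
    obtain ⟨-, -, y', hcy, hxy'⟩ := (hem c x).1 hc
    rw [← hf.2 x y y' hxy hxy'] at hcy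
    exact increasing_injective (wellOrders_mem hso) hno hgn hgs hgi hby hcy

theorem IsCofinality.unique {k k' d : M} (h : IsCofinality k d) (h' : IsCofinality k' d) :
    k = k' := by
  obtain ⟨⟨c, hc, hck⟩, h1⟩ := h
  obtain ⟨⟨c', hc', hck'⟩, h1'⟩ := h'
  exact (h1 c' k' hc' hck').antisymm (h1' c k hc hck)

/-- If `δ` has the cardinal `k` as its cofinality, then the image in `δ` of a set of size less
than `k` is bounded. -/
theorem bounded_image {k d i j : M} (hk : IsCardinal k) (hd : IsOrdinal d)
    (hkd : IsCofinality k d) (hi : i ∈ k) (hj : Inj j i) (R : M → M → Prop)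
    [h : Dfn fun v => R (v 0) (v 1)] (hR : ∀ x, x ∈ j → ∀ y y', R x y → R x y' → y = y') :
    ∃ a, a ∈ d ∧ ∀ x y, x ∈ j → y ∈ d → R x y → y ∈ a := by
  have inst : ∀ (t s : (ℕ → M) → M) [DfnTerm t] [DfnTerm s], Dfn fun v => R (t v) (s v) :=
    fun t s => h.subst₂ t s
  obtain ⟨f, hf, h1, h2⟩ := hj
  obtain ⟨r, hr⟩ := exists_sep d (fun y => ∃ x, x ∈ j ∧ R x y)
  have hrd : Sub r d := fun y hy => ((hr y).1 hy).1
  have hro : ∀ y, y ∈ r → IsOrdinal y := fun y hy => hd.mem (hrd y hy)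
  have hri : Inj r i := by
    refine Inj.of_rel (hk.1.mem hi) (fun y e => ∃ x, x ∈ j ∧ R x y ∧ Maps f x e) (fun y hy => ?_) ?_
    · obtain ⟨-, x, hx, hxy⟩ := (hr y).1 hy
      obtain ⟨e, he, hxe⟩ := h1 x hx
      exact ⟨e, he, x, hx, hxy, hxe⟩
    · rintro y y' e - - - ⟨x, hx, hxy, hxe⟩ ⟨x', hx', hxy', hxe'⟩
      obtain rfl := h2 x x' e hx hx' hxe hxe'
      exact hR x hx y y' hxy hxy'
  -- An unbounded image `r` would be cofinal, so of type at least `k`, yet it injects into `i < k`.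
  by_contra! hcon
  have hcof : IsCofinalIn r d := by
    refine ⟨hrd, fun a ha => ?_⟩
    obtain ⟨x, y, hx, hy, hxy, hya⟩ := hcon a ha
    exact ⟨y, (hr y).2 ⟨hy, x, hx, hxy⟩,
      ((hd.mem ha).le_or_lt (hd.mem hy)).resolve_right hya⟩
  obtain ⟨m, hm⟩ := exists_hasOrderType hro
  exact hk.not_inj hi hm.1 (hkd.2 r m hcof hm) ((hm.inj' hro).trans hri (hk.1.mem hi))

end OrderTypes

/-! ### Regular cardinals, small unions, and sequences from dependent choice -/

section Regular

variable {M : Type*} [Membership M M] [hM : Fact (IsModelZF M)]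

theorem IsRegularCardinal.isOrdinal {k : M} (hk : IsRegularCardinal k) : IsOrdinal k := hk.1.1

theorem IsRegularCardinal.exists_empty_mem {k : M} (hk : IsRegularCardinal k) :
    ∃ e i, e ∈ i ∧ i ∈ k := by
  obtain ⟨w, ⟨-, ⟨e, he, -⟩, hs, -⟩, hwk⟩ := hk.2.1
  obtain ⟨y, hy, hye⟩ := hs e he
  exact ⟨e, y, (hye e).2 (Or.inr rfl), OrdLe.lt_trans hy hwk hk.1.1⟩

/-- An ordinal whose cofinality is a regular cardinal is a limit. -/
theorem exists_gt {k d x : M} (hk : IsRegularCardinal k) (hd : IsOrdinal d)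
    (hkd : IsCofinality k d) (hx : x ∈ d) : ∃ y, y ∈ d ∧ x ∈ y := by
  obtain ⟨e, i, hei, hi⟩ := hk.exists_empty_mem
  obtain ⟨a, ha, h⟩ := bounded_image hk.1 hd hkd hi
    (inj_of_sub (hk.1.1.mem hi) (fun _ h => h)) (fun _ y => y = x)
    (fun _ _ _ _ h h' => h.trans h'.symm)
  exact ⟨a, ha, h e x hei hx rfl⟩

theorem exists_gt₂ {k d x y : M} (hk : IsRegularCardinal k) (hd : IsOrdinal d)
    (hkd : IsCofinality k d) (hx : x ∈ d) (hy : y ∈ d) : ∃ z, z ∈ d ∧ x ∈ z ∧ y ∈ z := by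
  rcases (hd.mem hx).le_or_lt (hd.mem hy) with h | h
  · obtain ⟨z, hz, hyz⟩ := exists_gt hk hd hkd hy
    exact ⟨z, hz, h.trans_lt hyz (hd.mem hz), hyz⟩
  · obtain ⟨z, hz, hxz⟩ := exists_gt hk hd hkd hx
    exact ⟨z, hz, hxz, (hd.mem hz).trans h hxz⟩

theorem exists_mem_of_isCofinality {k d : M} (hk : IsRegularCardinal k) (hd : IsOrdinal d)
    (hkd : IsCofinality k d) : ∃ x, x ∈ d := by
  obtain ⟨e, i, hei, hi⟩ := hk.exists_empty_mem
  obtain ⟨a, ha, -⟩ := bounded_image hk.1 hd hkd hi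
    (inj_of_sub (hk.1.1.mem hi) (fun _ h => h)) (fun x y => y = x)
    (fun _ _ _ _ h h' => h.trans h'.symm)
  exact ⟨a, ha⟩

/-- The lexicographic order of pairs of ordinals. -/
def LexLt (p q : M) : Prop :=
  ∃ a b a' b', p = opair a b ∧ q = opair a' b' ∧ (a ∈ a' ∨ a = a' ∧ b ∈ b')

instance (t s : (ℕ → M) → M) [DfnTerm t] [DfnTerm s] : Dfn fun v => LexLt (t v) (s v) := by
  unfold LexLt; infer_instance

theorem lexLt_opair {a b a' b' : M} :
    LexLt (opair a b) (opair a' b') ↔ a ∈ a' ∨ a = a' ∧ b ∈ b' := by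
  refine ⟨?_, fun h => ⟨a, b, a', b', rfl, rfl, h⟩⟩
  rintro ⟨c, d, c', d', h, h', h''⟩
  obtain ⟨rfl, rfl⟩ := opair_inj.1 h
  obtain ⟨rfl, rfl⟩ := opair_inj.1 h'
  exact h''

theorem wellOrders_lexLt {W : M}
    (hW : ∀ p, p ∈ W → ∃ a b, p = opair a b ∧ IsOrdinal a ∧ IsOrdinal b) :
    WellOrders LexLt W where
  irrefl p hp h := by
    obtain ⟨a, b, rfl, ha, hb⟩ := hW p hp
    rcases lexLt_opair.1 h with h | ⟨-, h⟩
    exacts [mem_irrefl a h, mem_irrefl b h]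
  trans p q r hp hq hr h h' := by
    obtain ⟨a, b, rfl, ha, hb⟩ := hW p hp
    obtain ⟨a', b', rfl, ha', hb'⟩ := hW q hq
    obtain ⟨c, d, rfl, hc, hd⟩ := hW r hr
    rw [lexLt_opair] at *
    rcases h with h | ⟨rfl, h⟩
    · rcases h' with h' | ⟨rfl, h'⟩
      exacts [Or.inl (hc.trans h h'), Or.inl h]
    · rcases h' with h' | ⟨rfl, h'⟩
      exacts [Or.inl h', Or.inr ⟨rfl, hd.trans h h'⟩]
  total p q hp hq := by
    obtain ⟨a, b, rfl, ha, hb⟩ := hW p hp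
    obtain ⟨a', b', rfl, ha', hb'⟩ := hW q hq
    rw [lexLt_opair, lexLt_opair]
    rcases ha.trichotomy ha' with h | rfl | h
    · exact Or.inl (Or.inl h)
    · rcases hb.trichotomy hb' with h | rfl | h
      · exact Or.inl (Or.inr ⟨rfl, h⟩)
      · exact Or.inr (Or.inl rfl)
      · exact Or.inr (Or.inr (Or.inr ⟨rfl, h⟩))
    · exact Or.inr (Or.inr (Or.inl h))
  wf s hs := by
    rintro ⟨p, hp⟩
    obtain ⟨a₀, b₀, rfl, ha₀, hb₀⟩ := hW p (hs p hp)
    obtain ⟨a, ha, -, ⟨b₁, hab, hb₁⟩, hamin⟩ :=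
      exists_least (fun a => ∃ b, opair a b ∈ s ∧ IsOrdinal b) ha₀ ⟨b₀, hp, hb₀⟩
    obtain ⟨b, hb, -, hab, hbmin⟩ := exists_least (fun b => opair a b ∈ s) hb₁ hab
    refine ⟨opair a b, hab, fun z hz h => ?_⟩
    obtain ⟨c, d, rfl, hc, hd⟩ := hW z (hs z hz)
    rcases lexLt_opair.1 h with h' | ⟨rfl, h'⟩
    exacts [hamin c h' ⟨d, hz, hd⟩, hbmin d h' hz]

/-- For a regular cardinal `k` and `θ < k`, a union of sets `{a} × W a` of size at most `θ`, where
`a` ranges over a set of ordinals with initial segments of size less than `k`, has size at most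
`k`. -/
theorem inj_of_fibers {k θ W I : M} (hk : IsRegularCardinal k) (hθ : θ ∈ k)
    (hI : ∀ a, a ∈ I → IsOrdinal a)
    (hW : ∀ p, p ∈ W → ∃ a b, p = opair a b ∧ a ∈ I ∧ IsOrdinal b)
    (h1 : ∀ a, a ∈ I → ∃ i s, i ∈ k ∧ Inj s i ∧ ∀ x, x ∈ I → OrdLe x a → x ∈ s)
    (h2 : ∀ a, a ∈ I → ∃ s, Inj s θ ∧ ∀ b, opair a b ∈ W → b ∈ s) : Inj W k := by
  have hko := hk.isOrdinal
  have hkk := hk.2.2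
  have hWO : WellOrders LexLt W := wellOrders_lexLt fun p hp => by
    obtain ⟨a, b, e, ha, hb⟩ := hW p hp
    exact ⟨a, b, e, hI a ha, hb⟩
  obtain ⟨m, hm⟩ := exists_relType LexLt hWO
  have hWm := hm.inj
  obtain ⟨hmo, g, hg, hgm, hgW, hgi⟩ := hm
  suffices hmk : OrdLe m k from hWm.mono_right ((hmo.le_iff_sub hko).1 hmk)
  refine (hmo.le_or_lt hko).resolve_right fun hkm => ?_
  -- If the type exceeds `k`, there is an element at position `k`, and everything before it lies in
  -- fibers over `a ≤ a₀`.
  obtain ⟨q, hq⟩ := (hgm k).1 hkm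
  obtain ⟨a₀, b₀, rfl, ha₀, hb₀⟩ := hW q ((hgW q).2 ⟨k, hq⟩)
  obtain ⟨i, s, hi, hsi, hs⟩ := h1 a₀ ha₀
  have hbd : ∀ a, a ∈ I → ∃ u, u ∈ k ∧ ∀ e b, e ∈ k → Maps g e (opair a b) → e ∈ u := by
    intro a ha
    obtain ⟨t, htθ, ht⟩ := h2 a ha
    obtain ⟨u, hu, h⟩ := bounded_image hk.1 hko hkk hθ htθ (fun b e => Maps g e (opair a b))
      fun b _ e e' h h' => increasing_injective hWO hmo hgm hgW hgi h h'
    exact ⟨u, hu, fun e b he heb => h b e (ht b ((hgW _).2 ⟨e, heb⟩)) he heb⟩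
  -- Each fiber occupies a bounded set of positions below `k`. Passing to least bounds avoids
  -- choosing injections of the fibers into `θ`. Fewer than `k` fibers are involved, so a single `u
  -- < k` exceeds all these bounds; but position `u` is itself occupied.
  obtain ⟨u, hu, hub⟩ := bounded_image hk.1 hko hkk hi hsi
    (fun a u => (u ∈ k ∧ ∀ e b, e ∈ k → Maps g e (opair a b) → e ∈ u) ∧
      ∀ u', u' ∈ u → ¬ (u' ∈ k ∧ ∀ e b, e ∈ k → Maps g e (opair a b) → e ∈ u')) (by
    rintro a - u u' ⟨hu, hl⟩ ⟨hu', hl'⟩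
    rcases (hko.mem hu.1).trichotomy (hko.mem hu'.1) with h | h | h
    exacts [(hl' u h hu).elim, h, (hl u' h hu').elim])
  obtain ⟨p, hp⟩ := (hgm u).1 (hmo.trans hu hkm)
  obtain ⟨a, b, rfl, ha, hb⟩ := hW p ((hgW p).2 ⟨u, hp⟩)
  have haa₀ : OrdLe a a₀ := by
    rcases lexLt_opair.1 (hgi u k _ _ hu hp hq) with h | ⟨h, -⟩
    exacts [Or.inr h, Or.inl h]
  obtain ⟨v, hv, hvb⟩ := hbd a ha
  obtain ⟨v', -, -, hv', hl⟩ := exists_least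
    (fun u => u ∈ k ∧ ∀ e b, e ∈ k → Maps g e (opair a b) → e ∈ u) (hko.mem hv) ⟨hv, hvb⟩
  exact mem_asymm (hub a v' (hs a ha haa₀) hv'.1 ⟨hv', hl⟩) (hv'.2 u b hu hp)

/-! ### Dependent choice -/

/-- The tree consists of the sequences of length below `θ` that obey `R` at every stage. The union
of a maximal branch obeys `R` too; were it shorter than `θ`, `hext` would extend it by one term and
so enlarge the branch. -/
theorem exists_dc_sequence {θ X : M} (hDC : DC θ) (hθ : IsOrdinal θ)
    (hlim : ∀ x, x ∈ θ → ∃ y, y ∈ θ ∧ x ∈ y) (R : M → M → Prop)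
    [h : Dfn fun v => R (v 0) (v 1)]
    (hext : ∀ t d, IsFunction t → d ∈ θ → IsDomain t d → (∀ x y, Maps t x y → y ∈ X) →
      (∀ j s x, IsRestriction s t j → Maps t j x → R s x) → ∃ x, x ∈ X ∧ R t x) :
    ∃ g, IsFunction g ∧ IsDomain g θ ∧ (∀ x y, Maps g x y → y ∈ X) ∧
      ∀ j s x, IsRestriction s g j → Maps g j x → R s x := by
  have inst : ∀ (t s : (ℕ → M) → M) [DfnTerm t] [DfnTerm s], Dfn fun v => R (t v) (s v) :=
    fun t s => h.subst₂ t s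
  obtain ⟨P, hP⟩ := exists_prod θ X
  obtain ⟨Q, hQ⟩ := hM.out.powerset P
  obtain ⟨T, hT⟩ := exists_sep Q (fun t => ∃ d, d ∈ θ ∧ IsFunction t ∧ IsDomain t d ∧
    (∀ x y, Maps t x y → y ∈ X) ∧ ∀ j s x, IsRestriction s t j → Maps t j x → R s x)
  have hT' : ∀ t d, d ∈ θ → IsFunction t → IsDomain t d → (∀ x y, Maps t x y → y ∈ X) →
      (∀ j s x, IsRestriction s t j → Maps t j x → R s x) → t ∈ T := by
    intro t d hd ht htd htX htR
    refine (hT t).2 ⟨(hQ t).2 fun p hp => ?_, d, hd, ht, htd, htX, htR⟩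
    obtain ⟨x, y, e⟩ := ht.1 p hp
    have hxy : Maps t x y := ⟨p, hp, e⟩
    exact (hP p).2 ⟨x, y, hθ.trans ((htd x).2 ⟨y, hxy⟩) hd, htX x y hxy, isPair_iff.1 e⟩
  have hTree : IsTree T θ X := by
    intro t ht
    obtain ⟨-, d, hd, htf, htd, htX, htR⟩ := (hT t).1 ht
    refine ⟨htf, htX, d, hd, htd, fun a ha => ?_⟩
    obtain ⟨s, hs, hsm⟩ := exists_function a (fun x y => Maps t x y)
      fun x _ y y' h h' => htf.2 x y y' h h'
    refine ⟨s, hT' s a (hθ.trans ha hd) hs (fun x => ⟨fun hx => ?_, ?_⟩) ?_ ?_, hs, hsm⟩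
    · obtain ⟨y, hy⟩ := (htd x).1 ((hθ.mem hd).trans hx ha)
      exact ⟨y, (hsm x y).2 ⟨hx, hy⟩⟩
    · rintro ⟨y, hy⟩
      exact ((hsm x y).1 hy).1
    · exact fun x y hxy => htX x y ((hsm x y).1 hxy).2
    · rintro j u x ⟨hu, hum⟩ hjx
      obtain ⟨hja, hjx⟩ := (hsm j x).1 hjx
      refine htR j u x ⟨hu, fun z y => ?_⟩ hjx
      rw [hum, hsm]
      exact ⟨fun h => ⟨h.1, h.2.2⟩, fun h => ⟨h.1, ((hθ.mem hd).mem ha).trans h.1 hja, h.2⟩⟩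
  obtain ⟨b, ⟨hbT, hbc⟩, hbmax⟩ := hDC X T hTree
  obtain ⟨U, hU⟩ := hM.out.union b
  have hUm : ∀ x y, Maps U x y ↔ ∃ t, t ∈ b ∧ Maps t x y := by
    intro x y
    simp only [maps_iff, hU]
  have hUf : IsFunction U := by
    refine ⟨fun p hp => ?_, fun x y y' h h' => ?_⟩
    · obtain ⟨t, ht, hpt⟩ := (hU p).1 hp
      exact (hTree t (hbT t ht)).1.1 p hpt
    · obtain ⟨t, ht, htx⟩ := (hUm x y).1 h
      obtain ⟨t', ht', htx'⟩ := (hUm x y').1 h'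
      rcases hbc t t' ht ht' with hs | hs
      · exact (hTree t' (hbT t' ht')).1.2 x y y' (htx.mono hs) htx'
      · exact (hTree t (hbT t ht)).1.2 x y y' htx (htx'.mono hs)
  have hUX : ∀ x y, Maps U x y → y ∈ X := by
    intro x y hxy
    obtain ⟨t, ht, htx⟩ := (hUm x y).1 hxy
    exact (hTree t (hbT t ht)).2.1 x y htx
  have hUtr : ∀ x y z, Maps U x y → z ∈ x → ∃ w, Maps U z w := by
    intro x y z hxy hzx
    obtain ⟨t, ht, htx⟩ := (hUm x y).1 hxy
    obtain ⟨d, hd, htd, -⟩ := (hTree t (hbT t ht)).2.2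
    obtain ⟨w, hw⟩ := (htd z).1 ((hθ.mem hd).trans hzx ((htd x).2 ⟨y, htx⟩))
    exact ⟨w, (hUm z w).2 ⟨t, ht, hw⟩⟩
  have hUR : ∀ j s x, IsRestriction s U j → Maps U j x → R s x := by
    rintro j s x ⟨hs, hsm⟩ hjx
    obtain ⟨t, ht, htj⟩ := (hUm j x).1 hjx
    obtain ⟨-, d, hd, htf, htd, htX, htR⟩ := (hT t).1 (hbT t ht)
    refine htR j s x ⟨hs, fun z y => ?_⟩ htj
    rw [hsm]
    refine and_congr_right fun hz => ⟨fun h => ?_, fun h => (hUm z y).2 ⟨t, ht, h⟩⟩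
    obtain ⟨w, hw⟩ := (htd z).1 ((hθ.mem hd).trans hz ((htd j).2 ⟨x, htj⟩))
    rwa [hUf.2 z y w h ((hUm z w).2 ⟨t, ht, hw⟩)]
  obtain ⟨D, hD⟩ := exists_sep θ (fun x => ∃ y, Maps U x y)
  have hUD : IsDomain U D := by
    refine fun x => ⟨fun hx => ((hD x).1 hx).2, ?_⟩
    rintro ⟨y, hy⟩
    obtain ⟨t, ht, htx⟩ := (hUm x y).1 hy
    obtain ⟨d, hd, htd, -⟩ := (hTree t (hbT t ht)).2.2
    exact (hD x).2 ⟨hθ.trans ((htd x).2 ⟨y, htx⟩) hd, y, hy⟩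
  have hDo : IsOrdinal D := isOrdinal_of_transitive (fun x hx => hθ.mem ((hD x).1 hx).1)
    fun x hx z hz => by
      obtain ⟨hxθ, y, hy⟩ := (hD x).1 hx
      exact (hD z).2 ⟨hθ.trans hz hxθ, hUtr x y z hy hz⟩
  rcases (hDo.le_iff_sub hθ).2 fun x hx => ((hD x).1 hx).1 with rfl | hDθ
  · exact ⟨U, hUf, hUD, hUX, hUR⟩
  obtain ⟨x, hxX, hRx⟩ := hext U D hUf hDθ hUD hUX hUR
  obtain ⟨V, hV⟩ := exists_insert U (opair D x)
  have hVm : ∀ z y, Maps V z y ↔ Maps U z y ∨ z = D ∧ y = x := by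
    intro z y
    rw [maps_iff, maps_iff, hV, opair_inj]
  have hDU : ∀ y, ¬ Maps U D y := fun y hy => mem_irrefl D ((hUD D).2 ⟨y, hy⟩)
  have hVf : IsFunction V := by
    refine ⟨fun p hp => ?_, fun z y y' h h' => ?_⟩
    · rcases (hV p).1 hp with h | rfl
      exacts [hUf.1 p h, ⟨D, x, isPair_opair D x⟩]
    · rcases (hVm z y).1 h with h | ⟨rfl, rfl⟩
      · rcases (hVm z y').1 h' with h' | ⟨rfl, rfl⟩
        exacts [hUf.2 z y y' h h', (hDU _ h).elim]
      · rcases (hVm z y').1 h' with h' | ⟨-, rfl⟩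
        exacts [(hDU _ h').elim, rfl]
  obtain ⟨E, hEo, hE⟩ := exists_succ hDo
  -- The tree only has sequences of length strictly below `θ`, so the extension, of length `D + 1`,
  -- is in it because `θ` is a limit.
  have hEθ : E ∈ θ := by
    obtain ⟨y, hy, hDy⟩ := hlim D hDθ
    refine OrdLe.trans_lt ((hEo.le_iff_sub (hθ.mem hy)).2 fun z hz => ?_) hy hθ
    rcases (hE z).1 hz with h | rfl
    exacts [(hθ.mem hy).trans h hDy, hDy]
  have hVE : IsDomain V E := by
    intro z
    rw [hE, hUD z]
    constructor
    · rintro (⟨y, hy⟩ | rfl)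
      exacts [⟨y, (hVm z y).2 (Or.inl hy)⟩, ⟨x, (hVm z x).2 (Or.inr ⟨rfl, rfl⟩)⟩]
    · rintro ⟨y, hy⟩
      rcases (hVm z y).1 hy with h | h
      exacts [Or.inl ⟨y, h⟩, Or.inr h.1]
  have hVX : ∀ z y, Maps V z y → y ∈ X := by
    intro z y h
    rcases (hVm z y).1 h with h | ⟨-, rfl⟩
    exacts [hUX z y h, hxX]
  have hVR : ∀ j s y, IsRestriction s V j → Maps V j y → R s y := by
    rintro j s y ⟨hs, hsm⟩ hjy
    have hjE : j ∈ E := (hVE j).2 ⟨y, hjy⟩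
    have hjD : ¬ D ∈ j := fun h => by
      rcases (hE j).1 hjE with h' | rfl
      exacts [mem_asymm h h', mem_irrefl j h]
    have hsU : IsRestriction s U j := by
      refine ⟨hs, fun z w => ?_⟩
      rw [hsm, hVm]
      refine and_congr_right fun hz => or_iff_left ?_
      rintro ⟨rfl, -⟩
      exact hjD hz
    rcases (hVm j y).1 hjy with h | ⟨rfl, rfl⟩
    · exact hUR j s y hsU h
    · have : s = U := hs.ext hUf fun z w => by
        rw [hsU.2, and_iff_right_iff_imp]
        exact fun h => (hUD z).2 ⟨w, h⟩
      exact this ▸ hRx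
  obtain ⟨b', hb'⟩ := exists_insert b V
  have hsub : ∀ t, t ∈ b → Sub t V := fun t ht p hp => (hV p).2 (Or.inl ((hU p).2 ⟨t, ht, hp⟩))
  have hbb' : b' = b := by
    refine hbmax b' ⟨fun t ht => ?_, fun s t hs ht => ?_⟩ fun t ht => (hb' t).2 (Or.inl ht)
    · rcases (hb' t).1 ht with h | rfl
      exacts [hbT t h, hT' t E hEθ hVf hVE hVX hVR]
    · rcases (hb' s).1 hs with h | rfl
      · rcases (hb' t).1 ht with h' | rfl
        exacts [hbc s t h h', Or.inl (hsub s h)]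
      · rcases (hb' t).1 ht with h' | rfl
        exacts [Or.inr (hsub t h'), Or.inl fun _ h => h]
  have hVb : V ∈ b := hbb' ▸ (hb' V).2 (Or.inr rfl)
  exact (hDU x ((hUm D x).2 ⟨V, hVb, (hVm D x).2 (Or.inr ⟨rfl, rfl⟩)⟩)).elim

end Regular

/-! ### Null intervals, and the cofinality and size of essential sets -/

section Ladders

variable {M : Type*} [Membership M M] [hM : Fact (IsModelZF M)]

/-- `F` is a weakly increasing function from the ordinal `d` to itself. -/
def IsMonotoneOn (F d : M) : Prop :=
  IsFunction F ∧ IsDomain F d ∧ (∀ x y, Maps F x y → y ∈ d) ∧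
    ∀ x x' y y', x ∈ x' → Maps F x y → Maps F x' y' → OrdLe y y'

/-- The ordinal `a` is closed under the function `F`. -/
def ClosedUnder (a F : M) : Prop := ∀ x y, x ∈ a → Maps F x y → y ∈ a

/-- For all `a < d` of cofinality `θ` that are closed under `F`, the `a`-th member of the
sequence `C` contains no element of the interval `[x, y)`. -/
def Avoids (C θ d F x y : M) : Prop :=
  ∀ a c z, a ∈ d → IsCofinality θ a → ClosedUnder a F → Maps C a c → z ∈ c → z ∈ y → z ∈ x

/-- Club many members of `C` avoid the interval `[x, y)`. -/
def IsNull (C θ d x y : M) : Prop := ∃ F, IsMonotoneOn F d ∧ Avoids C θ d F x y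

/-- The set of all `y < d` such that no interval `[x, y)` with `x < y` is null. -/
def IsEssentialSet (C θ d c : M) : Prop :=
  ∀ y, y ∈ c ↔ y ∈ d ∧ ∀ x, x ∈ y → ¬ IsNull C θ d x y

/-- `C` is a ladder system: a sequence `⟨c_a : a < l, cf(a) = θ⟩` of cofinal sets of size at
most `θ`. -/
structure IsLadderSystem (C θ l : M) : Prop where
  isFunction : IsFunction C
  exists_maps : ∀ a, a ∈ l → IsCofinality θ a → ∃ c, Maps C a c
  isCofinalIn : ∀ a c, Maps C a c → IsCofinalIn c a
  inj : ∀ a c, Maps C a c → Inj c θ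

section

variable (t s r u v w : (ℕ → M) → M) [DfnTerm t] [DfnTerm s] [DfnTerm r] [DfnTerm u] [DfnTerm v]
  [DfnTerm w]

instance : Dfn fun i => IsMonotoneOn (t i) (s i) := by unfold IsMonotoneOn; infer_instance
instance : Dfn fun i => ClosedUnder (t i) (s i) := by unfold ClosedUnder; infer_instance
instance : Dfn fun i => Avoids (t i) (s i) (r i) (u i) (v i) (w i) := by
  unfold Avoids; infer_instance
instance : Dfn fun i => IsNull (t i) (s i) (r i) (u i) (v i) := by unfold IsNull; infer_instance
instance : Dfn fun i => IsEssentialSet (t i) (s i) (r i) (u i) := by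
  unfold IsEssentialSet; infer_instance

end

theorem IsNull.mono {C θ d x y x' y' : M} (h : IsNull C θ d x y) (hx : Sub x x') (hy : Sub y' y) :
    IsNull C θ d x' y' := by
  obtain ⟨F, hF, hA⟩ := h
  exact ⟨F, hF, fun a c z ha hθ hc hm hz hzy => hx z (hA a c z ha hθ hc hm hz (hy z hzy))⟩

/-- `H` is the pointwise maximum, so one function enforces closure under two. -/
theorem exists_max {F G d : M} (hd : IsOrdinal d) (hF : IsMonotoneOn F d)
    (hG : IsMonotoneOn G d) : ∃ H, IsMonotoneOn H d ∧ ∀ a, a ∈ d → ClosedUnder a H →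
      ClosedUnder a F ∧ ClosedUnder a G := by
  obtain ⟨hF1, hF2, hF3, hF4⟩ := hF
  obtain ⟨hG1, hG2, hG3, hG4⟩ := hG
  obtain ⟨H, hH, hm⟩ := exists_function d
    (fun x y => ∃ a b, Maps F x a ∧ Maps G x b ∧ (y = a ∨ y = b) ∧ OrdLe a y ∧ OrdLe b y) (by
      rintro x - y y' ⟨a, b, ha, hb, e, h1, h2⟩ ⟨a', b', ha', hb', e', h1', h2'⟩
      obtain rfl := hF1.2 x a a' ha ha'
      obtain rfl := hG1.2 x b b' hb hb'
      rcases e with rfl | rfl <;> rcases e' with rfl | rfl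
      exacts [rfl, h1'.antisymm h2, h2'.antisymm h1, rfl])
  have hex : ∀ x, x ∈ d → ∃ a b y, Maps F x a ∧ Maps G x b ∧ Maps H x y ∧ OrdLe a y ∧
      OrdLe b y := by
    intro x hx
    obtain ⟨a, ha⟩ := (hF2 x).1 hx
    obtain ⟨b, hb⟩ := (hG2 x).1 hx
    rcases (hd.mem (hF3 x a ha)).le_or_lt (hd.mem (hG3 x b hb)) with h | h
    · exact ⟨a, b, b, ha, hb, (hm x b).2 ⟨hx, a, b, ha, hb, Or.inr rfl, h, OrdLe.refl b⟩, h,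
        OrdLe.refl b⟩
    · exact ⟨a, b, a, ha, hb, (hm x a).2 ⟨hx, a, b, ha, hb, Or.inl rfl, OrdLe.refl a, Or.inr h⟩,
        OrdLe.refl a, Or.inr h⟩
  have hHd : ∀ x y, Maps H x y → y ∈ d := by
    intro x y h
    obtain ⟨-, a, b, ha, hb, rfl | rfl, -, -⟩ := (hm x y).1 h
    exacts [hF3 x _ ha, hG3 x _ hb]
  refine ⟨H, ⟨hH, fun x => ⟨fun hx => ?_, ?_⟩, hHd, ?_⟩, fun a ha hcl => ⟨?_, ?_⟩⟩
  · obtain ⟨-, -, y, -, -, hy, -⟩ := hex x hx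
    exact ⟨y, hy⟩
  · rintro ⟨y, hy⟩
    exact ((hm x y).1 hy).1
  · intro x x' y y' hxx' hy hy'
    have hyo := hd.mem (hHd x' y' hy')
    obtain ⟨-, a, b, ha, hb, e, -, -⟩ := (hm x y).1 hy
    obtain ⟨-, a', b', ha', hb', -, h1, h2⟩ := (hm x' y').1 hy'
    rcases e with rfl | rfl
    exacts [(hF4 x x' _ a' hxx' ha ha').trans h1 hyo, (hG4 x x' _ b' hxx' hb hb').trans h2 hyo]
  · intro x b hx hxb
    obtain ⟨b', -, y, hb', -, hy, h, -⟩ := hex x (hd.trans hx ha)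
    rw [hF1.2 x b b' hxb hb']
    exact h.trans_lt (hcl x y hx hy) (hd.mem ha)
  · intro x b hx hxb
    obtain ⟨-, b', y, -, hb', hy, -, h⟩ := hex x (hd.trans hx ha)
    rw [hG1.2 x b b' hxb hb']
    exact h.trans_lt (hcl x y hx hy) (hd.mem ha)

theorem IsNull.trans {C θ d x y z : M} (hd : IsOrdinal d) (h : IsNull C θ d x y)
    (h' : IsNull C θ d y z) : IsNull C θ d x z := by
  obtain ⟨F, hF, hFA⟩ := h
  obtain ⟨G, hG, hGA⟩ := h'
  obtain ⟨H, hH, hcl⟩ := exists_max hd hF hG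
  refine ⟨H, hH, fun a c e ha hθ hc hm he hez => ?_⟩
  obtain ⟨h1, h2⟩ := hcl a ha hc
  exact hFA a c e ha hθ h1 hm he (hGA a c e ha hθ h2 hm he hez)

/-- The supremum of an increasing sequence of length a regular cardinal `θ` has cofinality `θ`. -/
theorem isCofinality_of_increasing {θ g r a : M} (hθ : IsRegularCardinal θ) (ha : IsOrdinal a)
    (hg : IsFunction g) (hgθ : IsDomain g θ) (hgr : IsRange g r)
    (hgi : ∀ b c y z, b ∈ c → Maps g b y → Maps g c z → y ∈ z)
    (har : ∀ z, z ∈ a ↔ ∃ y, y ∈ r ∧ z ∈ y) : IsCofinality θ a := by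
  have hθo := hθ.isOrdinal
  have hra : Sub r a := by
    intro y hy
    obtain ⟨i, hi⟩ := (hgr y).1 hy
    obtain ⟨i', hi', hii'⟩ := exists_gt hθ hθo hθ.2.2 ((hgθ i).2 ⟨y, hi⟩)
    obtain ⟨y', hy'⟩ := (hgθ i').1 hi'
    exact (har y).2 ⟨y', (hgr y').2 ⟨i', hy'⟩, hgi i i' y y' hii' hi hy'⟩
  refine ⟨⟨r, ⟨hra, fun z hz => ?_⟩, hθo, g, hg, hgθ, hgr, hgi⟩, fun c m hc hm => ?_⟩
  · obtain ⟨y, hy, hzy⟩ := (har z).1 hz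
    exact ⟨y, hy, Or.inr hzy⟩
  refine (hθo.le_or_lt hm.1).resolve_right fun hmθ => ?_
  -- Send each `x ∈ c` to the least `i` with `x < g(i)`. For `c` of type below `θ` these indices are
  -- bounded in `θ`, so `c` is bounded in `a`.
  obtain ⟨i, hi, hbd⟩ := bounded_image hθ.1 hθo hθ.2.2 hmθ hm.inj
    (fun x i => (i ∈ θ ∧ ∃ y, Maps g i y ∧ x ∈ y) ∧ ∀ i', i' ∈ i →
      ¬ (i' ∈ θ ∧ ∃ y, Maps g i' y ∧ x ∈ y)) (by
    rintro x - i i' ⟨hi, hl⟩ ⟨hi', hl'⟩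
    rcases (hθo.mem hi.1).trichotomy (hθo.mem hi'.1) with h | h | h
    exacts [(hl' i h hi).elim, h, (hl i' h hi').elim])
  obtain ⟨y, hy⟩ := (hgθ i).1 hi
  obtain ⟨x, hxc, hyx⟩ := hc.2 y (hra y ((hgr y).2 ⟨i, hy⟩))
  obtain ⟨y', hy', hxy'⟩ := (har x).1 (hc.1 x hxc)
  obtain ⟨j, hj⟩ := (hgr y').1 hy'
  have hjθ := (hgθ j).2 ⟨y', hj⟩
  obtain ⟨j', -, -, hj', hl⟩ := exists_least (fun i => i ∈ θ ∧ ∃ y, Maps g i y ∧ x ∈ y)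
    (hθo.mem hjθ) ⟨hjθ, y', hj, hxy'⟩
  have hji : j' ∈ i := hbd x j' hxc hj'.1 ⟨hj', hl⟩
  obtain ⟨-, w, hw, hxw⟩ := hj'
  exact hyx.not_lt ((ha.mem (hra y ((hgr y).2 ⟨i, hy⟩))).trans hxw (hgi j' i w y hji hw hy))

theorem exists_not_isNull {C θ l d k x : M} (hl : IsOrdinal l) (hC : IsLadderSystem C θ l)
    (hθ : IsRegularCardinal θ) (hDC : DC θ) (hk : IsRegularCardinal k) (hθk : θ ∈ k)
    (hdl : d ∈ l) (hkd : IsCofinality k d) (hx : x ∈ d) :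
    ∃ y, y ∈ d ∧ x ∈ y ∧ ¬ IsNull C θ d x y := by
  by_contra! hcon
  have hd := hl.mem hdl
  have hθo := hθ.isOrdinal
  obtain ⟨P, hP⟩ := exists_prod d d
  obtain ⟨Q, hQ⟩ := hM.out.powerset P
  obtain ⟨Y, hY⟩ := exists_prod d Q
  -- The terms of the sequence are pairs `(b, F)` with `F` witnessing that `[x, b)` is null.
  obtain ⟨X, hX⟩ := exists_sep Y
    (fun p => ∃ b F, p = opair b F ∧ b ∈ d ∧ x ∈ b ∧ IsMonotoneOn F d ∧ Avoids C θ d F x b)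
  have hXi : ∀ b F, b ∈ d → x ∈ b → IsMonotoneOn F d → Avoids C θ d F x b → opair b F ∈ X := by
    intro b F hb hxb hF hA
    refine (hX _).2 ⟨(hY _).2 ⟨b, F, hb, (hQ F).2 fun p hp => ?_, rfl⟩, b, F, rfl, hb, hxb, hF, hA⟩
    obtain ⟨z, y, e⟩ := hF.1.1 p hp
    have hzy : Maps F z y := ⟨p, hp, e⟩
    exact (hP p).2 ⟨z, y, (hF.2.1 z).2 ⟨y, hzy⟩, hF.2.2.1 z y hzy, isPair_iff.1 e⟩
  have hXe : ∀ b F, opair b F ∈ X → b ∈ d ∧ x ∈ b ∧ IsMonotoneOn F d ∧ Avoids C θ d F x b := by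
    intro b F h
    obtain ⟨-, b', F', e, h⟩ := (hX _).1 h
    obtain ⟨rfl, rfl⟩ := opair_inj.1 e
    exact h
  have hXp : ∀ p, p ∈ X → ∃ b F, p = opair b F := by
    intro p hp
    obtain ⟨-, b, F, e, -⟩ := (hX p).1 hp
    exact ⟨b, F, e⟩
  obtain ⟨g, hg, hgθ, hgX, hgR⟩ := exists_dc_sequence (X := X) hDC hθo
    (fun i hi => exists_gt hθ hθo hθ.2.2 hi)
    -- The new ordinal must exceed every earlier ordinal and all values of earlier functions at
    -- earlier ordinals.
    (fun t p => ∀ b F : M, p = opair b F → ∀ j j' c G c' G' : M, Maps t j (opair c G) →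
      Maps t j' (opair c' G') → c' ∈ b ∧ ∀ y, Maps G c' y → y ∈ b) (by
    intro t D ht hDθ htD htX _
    have hDk := hk.isOrdinal.trans hDθ hθk
    have hDi : Inj D D := inj_of_sub (hθo.mem hDθ) fun _ h => h
    obtain ⟨s, hs, hsb⟩ := bounded_image hk.1 hd hkd hDk hDi
      (fun j b => ∃ G, Maps t j (opair b G)) (by
      rintro j - b b' ⟨G, h⟩ ⟨G', h'⟩
      exact (opair_inj.1 (ht.2 j _ _ h h')).1)
    -- All earlier ordinals are below `s`, so by monotonicity it is enough to exceed the values of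
    -- the earlier functions at `s`.
    obtain ⟨s', hs', hsb'⟩ := bounded_image hk.1 hd hkd hDk hDi
      (fun j y => ∃ b G : M, Maps t j (opair b G) ∧ Maps G s y) (by
      rintro j - y y' ⟨b, G, h, hy⟩ ⟨b', G', h', hy'⟩
      obtain ⟨rfl, rfl⟩ := opair_inj.1 (ht.2 j _ _ h h')
      exact (hXe b G (htX _ _ h)).2.2.1.1.2 s y y' hy hy')
    obtain ⟨e, he, hse, hs'e⟩ := exists_gt₂ hk hd hkd hs hs'
    obtain ⟨b, hb, heb, hxb⟩ := exists_gt₂ hk hd hkd he hx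
    have hbo := hd.mem hb
    obtain ⟨F, hF, hA⟩ := hcon b hb hxb
    refine ⟨opair b F, hXi b F hb hxb hF hA, ?_⟩
    intro b' F' e' j j' c G c' G' hj hj'
    obtain ⟨rfl, rfl⟩ := opair_inj.1 e'
    have hc's : c' ∈ s := hsb j' c' ((htD j').2 ⟨_, hj'⟩) (hXe c' G' (htX _ _ hj')).1 ⟨G', hj'⟩
    refine ⟨hbo.trans (hbo.mem heb |>.trans hc's hse) heb, fun y hy => ?_⟩
    have hG := (hXe c G (htX _ _ hj)).2.2.1
    obtain ⟨w, hw⟩ := (hG.2.1 s).1 hs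
    have hws' : w ∈ s' := hsb' j w ((htD j).2 ⟨_, hj⟩) (hG.2.2.1 s w hw) ⟨c, G, hj, hw⟩
    exact (hG.2.2.2 c' s y w hc's hy hw).trans_lt
      (hbo.trans (hbo.mem heb |>.trans hws' hs'e) heb) hbo)
  have hval : ∀ i, i ∈ θ → ∃ b F, Maps g i (opair b F) := by
    intro i hi
    obtain ⟨p, hp⟩ := (hgθ i).1 hi
    obtain ⟨b, F, rfl⟩ := hXp p (hgX i p hp)
    exact ⟨b, F, hp⟩
  have hinc : ∀ i j j' b F c G c' G', j ∈ i → j' ∈ i → Maps g i (opair b F) →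
      Maps g j (opair c G) → Maps g j' (opair c' G') → c' ∈ b ∧ ∀ y, Maps G c' y → y ∈ b := by
    intro i j j' b F c G c' G' hj hj' hi hjc hjc'
    obtain ⟨s, hs, hsm⟩ := exists_function i (fun x y => Maps g x y)
      fun x _ y y' h h' => hg.2 x y y' h h'
    exact hgR i s _ ⟨hs, hsm⟩ hi b F rfl j j' c G c' G' ((hsm _ _).2 ⟨hj, hjc⟩)
      ((hsm _ _).2 ⟨hj', hjc'⟩)
  obtain ⟨q, hq, hqm⟩ := exists_function θ (fun i b => ∃ F, Maps g i (opair b F)) (by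
    rintro j - b b' ⟨G, h⟩ ⟨G', h'⟩
    exact (opair_inj.1 (hg.2 j _ _ h h')).1)
  obtain ⟨r, hr⟩ := exists_sep d (fun b => ∃ i, Maps q i b)
  have hqd : ∀ i b, Maps q i b → b ∈ d ∧ x ∈ b := by
    intro i b h
    obtain ⟨-, F, hF⟩ := (hqm i b).1 h
    have := hXe b F (hgX _ _ hF)
    exact ⟨this.1, this.2.1⟩
  have hqr : IsRange q r := fun b => ⟨fun hb => ((hr b).1 hb).2, fun ⟨i, hi⟩ =>
    (hr b).2 ⟨(hqd i b hi).1, i, hi⟩⟩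
  have hqθ : IsDomain q θ := by
    refine fun i => ⟨fun hi => ?_, fun ⟨b, hb⟩ => ((hqm i b).1 hb).1⟩
    obtain ⟨b, F, h⟩ := hval i hi
    exact ⟨b, (hqm i b).2 ⟨hi, F, h⟩⟩
  have hqi : ∀ i j b c, i ∈ j → Maps q i b → Maps q j c → b ∈ c := by
    intro i j b c hij hb hc
    obtain ⟨-, F, hF⟩ := (hqm i b).1 hb
    obtain ⟨-, G, hG⟩ := (hqm j c).1 hc
    exact (hinc j i i c G b F b F hij hij hG hF hF).1
  obtain ⟨a, hao, ha⟩ := exists_union_isOrdinal (s := r) fun b hb => hd.mem ((hr b).1 hb).1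
  have had : a ∈ d := by
    obtain ⟨e, he, heb⟩ := bounded_image hk.1 hd hkd hθk (inj_of_sub hθo fun _ h => h)
      (fun i b => Maps q i b) fun i _ b b' h h' => hq.2 i b b' h h'
    refine OrdLe.trans_lt ((hao.le_iff_sub (hd.mem he)).2 fun z hz => ?_) he hd
    obtain ⟨b, hb, hzb⟩ := (ha z).1 hz
    obtain ⟨hbd, i, hi⟩ := (hr b).1 hb
    exact (hd.mem he).trans hzb (heb i b ((hqθ i).2 ⟨b, hi⟩) hbd hi)
  have hcof : IsCofinality θ a := isCofinality_of_increasing hθ hao hq hqθ hqr hqi ha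
  obtain ⟨c, hc⟩ := hC.exists_maps a (hl.trans had hdl) hcof
  obtain ⟨i₀, hi₀⟩ := exists_mem_of_isCofinality hθ hθo hθ.2.2
  have hxa : x ∈ a := by
    obtain ⟨b, hb⟩ := (hqθ i₀).1 hi₀
    exact (ha x).2 ⟨b, (hqr b).2 ⟨i₀, hb⟩, (hqd i₀ b hb).2⟩
  obtain ⟨z, hzc, hxz⟩ := (hC.isCofinalIn a c hc).2 x hxa
  obtain ⟨b, hb, hzb⟩ := (ha z).1 ((hC.isCofinalIn a c hc).1 z hzc)
  obtain ⟨i, hi⟩ := (hqr b).1 hb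
  obtain ⟨hiθ, F, hF⟩ := (hqm i b).1 hi
  obtain ⟨-, -, hFm, hFA⟩ := hXe b F (hgX _ _ hF)
  -- It remains to see that `a` is closed under `F`. If `e` is below the `i'`-th ordinal `b'`, then
  -- `F(e) ≤ F(b')`, which is below the `j`-th ordinal for any `j > i, i'`.
  refine hxz.not_lt (hFA a c z had hcof (fun e y hea hey => ?_) hc hzc hzb)
  obtain ⟨b', hb', heb'⟩ := (ha e).1 hea
  obtain ⟨i', hi'⟩ := (hqr b').1 hb'
  obtain ⟨hi'θ, F', hF'⟩ := (hqm i' b').1 hi'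
  obtain ⟨j, hj, hij, hi'j⟩ := exists_gt₂ hθ hθo hθ.2.2 hiθ hi'θ
  obtain ⟨b'', F'', hF''⟩ := hval j hj
  obtain ⟨w, hw⟩ := (hFm.2.1 b').1 (hqd i' b' hi').1
  have hb''r : Maps q j b'' := (hqm j b'').2 ⟨hj, F'', hF''⟩
  have hwb'' : w ∈ b'' := (hinc j i i' b'' F'' b F b' F' hij hi'j hF'' hF hF').2 w hw
  exact (ha y).2 ⟨b'', (hqr b'').2 ⟨j, hb''r⟩,
    (hFm.2.2.2 e b' y w heb' hey hw).trans_lt hwb'' (hd.mem (hqd j b'' hb''r).1)⟩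

/-- The least `y` with `[x, y)` not null is essential: if `[z, y)` were null with `x < z`, then `[x,
z)` is null by minimality, and so would be the union. For `z ≤ x`, `[x, y)` is a subinterval. -/
theorem IsEssentialSet.isCofinalIn {C θ l d k c : M} (hl : IsOrdinal l)
    (hC : IsLadderSystem C θ l) (hθ : IsRegularCardinal θ) (hDC : DC θ)
    (hk : IsRegularCardinal k) (hθk : θ ∈ k) (hdl : d ∈ l) (hkd : IsCofinality k d)
    (hc : IsEssentialSet C θ d c) : IsCofinalIn c d := by
  have hd := hl.mem hdl
  refine ⟨fun y hy => ((hc y).1 hy).1, fun x hx => ?_⟩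
  obtain ⟨y₀, hy₀, h₀⟩ := exists_not_isNull hl hC hθ hDC hk hθk hdl hkd hx
  obtain ⟨y, hy, hyy₀, ⟨hxy, hnull⟩, hmin⟩ :=
    exists_least (fun y => x ∈ y ∧ ¬ IsNull C θ d x y) (hd.mem hy₀) h₀
  refine ⟨y, (hc y).2 ⟨hyy₀.trans_lt hy₀ hd, fun z hz hzy => hnull ?_⟩, Or.inr hxy⟩
  rcases (hy.mem hz).le_or_lt (hy.mem hxy) with h | h
  · exact hzy.mono (((hy.mem hz).le_iff_sub (hy.mem hxy)).1 h) fun _ h => h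
  · exact IsNull.trans hd (by_contra fun h' => hmin z hz ⟨h, h'⟩) hzy

/-- For cofinal `D ⊆ d`, there is a monotone function such that between any two elements of an
ordinal that is closed under it, there is one of `D`. -/
theorem exists_next {d k D : M} (hk : IsRegularCardinal k) (hd : IsOrdinal d)
    (hkd : IsCofinality k d) (hD : IsCofinalIn D d) : ∃ F, IsMonotoneOn F d ∧
      ∀ a x, a ∈ d → ClosedUnder a F → x ∈ a → ∃ y, y ∈ D ∧ x ∈ y ∧ y ∈ a := by
  obtain ⟨F, hF, hm⟩ := exists_function d
    (fun x y => (y ∈ D ∧ x ∈ y) ∧ ∀ y', y' ∈ y → ¬ (y' ∈ D ∧ x ∈ y')) (by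
      rintro x - y y' ⟨hy, hl⟩ ⟨hy', hl'⟩
      rcases (hd.mem (hD.1 y hy.1)).trichotomy (hd.mem (hD.1 y' hy'.1)) with h | h | h
      exacts [(hl' y h hy).elim, h, (hl y' h hy').elim])
  have hFd : IsDomain F d := by
    refine fun x => ⟨fun hx => ?_, fun ⟨y, hy⟩ => ((hm x y).1 hy).1⟩
    obtain ⟨y, hy, hxy⟩ := exists_gt hk hd hkd hx
    obtain ⟨z, hz, hyz⟩ := hD.2 y hy
    have hzo := hd.mem (hD.1 z hz)
    obtain ⟨w, -, -, hw, hl⟩ := exists_least (fun y => y ∈ D ∧ x ∈ y) hzo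
      ⟨hz, OrdLe.lt_trans hxy hyz hzo⟩
    exact ⟨w, (hm x w).2 ⟨hx, hw, hl⟩⟩
  refine ⟨F, ⟨hF, hFd, fun x y hxy => hD.1 y ((hm x y).1 hxy).2.1.1, ?_⟩, fun a x ha hcl hx => ?_⟩
  · intro x x' y y' hxx' hy hy'
    obtain ⟨-, h, hl⟩ := (hm x y).1 hy
    obtain ⟨-, h', -⟩ := (hm x' y').1 hy'
    have hyo' := hd.mem (hD.1 y' h'.1)
    exact ((hd.mem (hD.1 y h.1)).le_or_lt hyo').resolve_right fun h'' =>
      hl y' h'' ⟨h'.1, hyo'.trans hxx' h'.2⟩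
  · obtain ⟨y, hy⟩ := (hFd x).1 (hd.trans hx ha)
    obtain ⟨-, h, -⟩ := (hm x y).1 hy
    exact ⟨y, h.1, h.2, hcl x y hx hy⟩

/-- If every element of `I` is a limit of a set `D` of regular order type `k`, then the proper
initial segments of `I` have size less than `k`. -/
theorem exists_inj_segment {d k D I a : M} (hk : IsRegularCardinal k) (hd : IsOrdinal d)
    (hD : IsCofinalIn D d) (hDk : HasOrderType D k) (hI : Sub I d)
    (hlim : ∀ x y, y ∈ I → x ∈ y → ∃ z, z ∈ D ∧ x ∈ z ∧ z ∈ y) (ha : a ∈ I) :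
    ∃ i s, i ∈ k ∧ Inj s i ∧ ∀ x, x ∈ I → OrdLe x a → x ∈ s := by
  have hko := hk.isOrdinal
  obtain ⟨-, g, hg, hgk, hgD, hgi⟩ := hDk
  have hao := hd.mem (hI a ha)
  obtain ⟨z₀, hz₀, haz₀⟩ := hD.2 a (hI a ha)
  have hz₀o := hd.mem (hD.1 z₀ hz₀)
  obtain ⟨e₀, he₀⟩ := (hgD z₀).1 hz₀
  have he₀k := (hgk e₀).2 ⟨z₀, he₀⟩
  obtain ⟨i, hi, he₀i⟩ := exists_gt hk hko hk.2.2 he₀k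
  obtain ⟨s, hs⟩ := exists_sep I (fun x => OrdLe x a)
  -- The injection sends `x` to the position of the first element of `D` that is at least `x`. An
  -- element of `D` strictly between `x` and `x'` keeps their positions apart.
  have hne : ∀ x x' e, x' ∈ I → x ∈ x' → (∃ y, Maps g e y ∧ OrdLe x' y) →
      (∀ e', e' ∈ e → ¬ ∃ y, Maps g e' y ∧ OrdLe x y) → False := by
    rintro x x' e hx' hxx' ⟨y, hy, hx'y⟩ hl
    obtain ⟨z, hz, hxz, hzx'⟩ := hlim x x' hx' hxx'
    obtain ⟨e', he'⟩ := (hgD z).1 hz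
    have hyo := hd.mem (hD.1 y ((hgD y).2 ⟨e, hy⟩))
    have hzy : z ∈ y := OrdLe.lt_trans hzx' hx'y hyo
    rcases (hko.mem ((hgk e').2 ⟨z, he'⟩)).trichotomy (hko.mem ((hgk e).2 ⟨y, hy⟩)) with h | rfl | h
    · exact hl e' h ⟨z, he', Or.inr hxz⟩
    · rw [hg.2 e' z y he' hy] at hzy
      exact mem_irrefl y hzy
    · exact mem_asymm hzy (hgi e e' y z h hy he')
  refine ⟨i, s, hi, Inj.of_rel (hko.mem hi) (fun x e => (∃ y, Maps g e y ∧ OrdLe x y) ∧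
    ∀ e', e' ∈ e → ¬ ∃ y, Maps g e' y ∧ OrdLe x y) (fun x hx => ?_) ?_,
    fun x hx hxa => (hs x).2 ⟨hx, hxa⟩⟩
  · obtain ⟨hxI, hxa⟩ := (hs x).1 hx
    obtain ⟨e, -, hee₀, he, hl⟩ := exists_least (fun e => ∃ y, Maps g e y ∧ OrdLe x y)
      (hko.mem he₀k) ⟨z₀, he₀, hxa.trans haz₀ hz₀o⟩
    exact ⟨e, hee₀.trans_lt he₀i (hko.mem hi), he, hl⟩
  · rintro x x' e hx hx' - ⟨h, hl⟩ ⟨h', hl'⟩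
    have hxI := ((hs x).1 hx).1
    have hxI' := ((hs x').1 hx').1
    rcases (hd.mem (hI x hxI)).trichotomy (hd.mem (hI x' hxI')) with h'' | h'' | h''
    exacts [(hne x x' e hxI' h'' h' hl).elim, h'', (hne x' x e hxI h'' h hl').elim]

theorem IsEssentialSet.inj {C θ l d k c : M} (hl : IsOrdinal l)
    (hC : IsLadderSystem C θ l) (hk : IsRegularCardinal k) (hθk : θ ∈ k) (hdl : d ∈ l)
    (hkd : IsCofinality k d) (hc : IsEssentialSet C θ d c) (hcd : IsCofinalIn c d) :
    Inj c k := by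
  have hd := hl.mem hdl
  obtain ⟨D, hD, hDk⟩ := hkd.1
  obtain ⟨F, hF, hFD⟩ := exists_next hk hd hkd hD
  -- By the choice of `F`, every point of `I` is a limit of `D`, so the initial segments of `I` are
  -- smaller than `k`.
  obtain ⟨I, hI⟩ := exists_sep d (fun a => IsCofinality θ a ∧ ClosedUnder a F)
  have hId : Sub I d := fun a ha => ((hI a).1 ha).1
  obtain ⟨P, hP⟩ := exists_prod d d
  obtain ⟨W, hW⟩ := exists_sep P
    (fun p => ∃ a e z, p = opair a z ∧ a ∈ I ∧ Maps C a e ∧ z ∈ e)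
  have hWi : ∀ a e z, a ∈ I → Maps C a e → z ∈ e → opair a z ∈ W := fun a e z ha he hz =>
    (hW _).2 ⟨(hP _).2 ⟨a, z, hId a ha, hd.trans ((hC.isCofinalIn a e he).1 z hz) (hId a ha), rfl⟩,
      a, e, z, rfl, ha, he, hz⟩
  have hWk : Inj W k := by
    refine inj_of_fibers hk hθk (fun a ha => hd.mem (hId a ha)) (fun p hp => ?_) (fun a ha =>
      exists_inj_segment hk hd hD hDk hId (fun x y hy hxy =>
        hFD y x (hId y hy) ((hI y).1 hy).2.2 hxy) ha) fun a ha => ?_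
    · obtain ⟨-, a, e, z, rfl, ha, he, hz⟩ := (hW p).1 hp
      exact ⟨a, z, rfl, ha, (hd.mem (hId a ha)).mem ((hC.isCofinalIn a e he).1 z hz)⟩
    · obtain ⟨had, hθa, -⟩ := (hI a).1 ha
      obtain ⟨e, he⟩ := hC.exists_maps a (hl.trans had hdl) hθa
      refine ⟨e, hC.inj a e he, fun b hb => ?_⟩
      obtain ⟨-, a', e', z, h, -, he', hz⟩ := (hW _).1 hb
      obtain ⟨rfl, rfl⟩ := opair_inj.1 h
      rwa [hC.isFunction.2 a e e' he he']
  obtain ⟨h, hf, h1, h2⟩ := hWk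
  -- Relate `b` to the codes of pairs `(a, z)` with `z` at least `b` and below all later members of
  -- `c`. Such a `z` determines `b`.
  refine Inj.of_rel hk.isOrdinal (fun b i => ∃ a z : M, opair a z ∈ W ∧ Maps h (opair a z) i ∧
    OrdLe b z ∧ ∀ b', b' ∈ c → b ∈ b' → z ∈ b') (fun b hb => ?_) ?_
  · obtain ⟨y, hy, hby⟩ := exists_gt hk hd hkd (hcd.1 b hb)
    obtain ⟨b₀, hb₀, hyb₀⟩ := hcd.2 y hy
    have hb₀o := hd.mem (hcd.1 b₀ hb₀)
    obtain ⟨b₁, hb₁o, -, ⟨hb₁, hbb₁⟩, hl'⟩ := exists_least (fun b' => b' ∈ c ∧ b ∈ b') hb₀o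
      ⟨hb₀, OrdLe.lt_trans hby hyb₀ hb₀o⟩
    -- As `b₁`, the successor of `b` in `c`, is essential, `[b, b₁)` is not null; so this particular
    -- `F` fails, which yields `a ∈ I` and `z ∈ c_a` in the interval.
    have hnull : ¬ Avoids C θ d F b b₁ := fun hA => ((hc b₁).1 hb₁).2 b hbb₁ ⟨F, hF, hA⟩
    unfold Avoids at hnull
    push Not at hnull
    obtain ⟨a, e, z, had, hθa, hcl, he, hz, hzb₁, hzb⟩ := hnull
    have hp := hWi a e z ((hI a).2 ⟨had, hθa, hcl⟩) he hz
    obtain ⟨i, hi, hpi⟩ := h1 _ hp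
    refine ⟨i, hi, a, z, hp, hpi, ((hb₁o.mem hbb₁).le_or_lt (hb₁o.mem hzb₁)).resolve_right hzb, ?_⟩
    intro b' hb' hbb'
    have hbo' := hd.mem (hcd.1 b' hb')
    refine OrdLe.lt_trans hzb₁ ((hb₁o.le_or_lt hbo').resolve_right fun h => ?_) hbo'
    exact hl' b' h ⟨hb', hbb'⟩
  · rintro b b' i hb hb' - ⟨a, z, hp, hpi, hbz, hz⟩ ⟨a', z', hp', hpi', hbz', hz'⟩
    obtain ⟨rfl, rfl⟩ := opair_inj.1 (h2 _ _ i hp hp' hpi hpi')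
    rcases (hd.mem (hcd.1 b hb)).trichotomy (hd.mem (hcd.1 b' hb')) with h | h | h
    exacts [(hbz'.not_lt (hz b' hb' h)).elim, h, (hbz.not_lt (hz' b hb h)).elim]

/-- A type below `θ + 1` is at most `θ`; only the resulting injection into `θ` is used later. -/
theorem Psi.exists_isLadderSystem {l θ : M} (hθ : IsOrdinal θ) (h : Psi l θ) :
    ∃ C, IsLadderSystem C θ l := by
  obtain ⟨f, ⟨n, p, hn, hp, hf⟩, C, hC, hdom, hw⟩ := h
  have hfm : ∀ x y, Maps f x y ↔ x = θ ∧ y = n := by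
    intro x y
    rw [isPair_iff] at hp
    rw [maps_iff, hf, or_self, hp, opair_inj]
  have hno : IsOrdinal n := by
    obtain ⟨n', hn'o, hn'⟩ := exists_succ hθ
    rwa [ext fun z => (hn z).trans (hn' z).symm]
  have key : ∀ a c, Maps C a c → IsCofinalIn c a ∧ ∃ m, HasOrderType c m ∧ m ∈ n := by
    intro a c hac
    obtain ⟨-, k, n', hk, hkn⟩ := (hdom a).1 ⟨c, hac⟩
    obtain ⟨rfl, rfl⟩ := (hfm k n').1 hkn
    exact hw a c k n' hac hk hkn
  refine ⟨C, hC, fun a ha hθa => (hdom a).2 ⟨ha, θ, n, hθa, (hfm θ n).2 ⟨rfl, rfl⟩⟩,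
    fun a c h => (key a c h).1, fun a c h => ?_⟩
  obtain ⟨-, m, hm, hmn⟩ := key a c h
  refine hm.inj.mono_right fun z hz => ?_
  rcases (hn m).1 hmn with h | rfl
  exacts [hθ.trans hz h, hz]

/-- A type at or above `k⁺` would inject into `k` through `c`. -/
theorem exists_orderType_mem_succ {c k n : M} (hc : ∀ x, x ∈ c → IsOrdinal x) (h : Inj c k)
    (hn : IsCardinalSucc n k) : ∃ a, HasOrderType c a ∧ a ∈ n := by
  obtain ⟨a, ha⟩ := exists_hasOrderType hc
  refine ⟨a, ha, (hn.1.1.le_or_lt ha.1).resolve_left fun h' => ?_⟩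
  exact hn.1.not_inj hn.2.1 ha.1 h' ((ha.inj' hc).trans h (hn.1.1.mem hn.2.1))

end Ladders

end SetModel

theorem corollary3p2 {M : Type*} [Membership M M] (hM : SetModel.IsModelZF M)
    (θ l A f : M)
    (hθ : SetModel.IsRegularCardinal θ) (hDC : SetModel.DC θ)
    (hl : SetModel.IsOrdinal l)
    (hcf : ∃ m, SetModel.IsCofinality m l ∧ θ ∈ m)
    (hA : SetModel.IsRegularInterval A θ l)
    (hf : SetModel.IsCardinalSuccOn f A) :
    SetModel.Psi l θ → SetModel.Phi l f := by
  open SetModel in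
  intro hpsi
  have : Fact (IsModelZF M) := ⟨hM⟩
  obtain ⟨C, hC⟩ := hpsi.exists_isLadderSystem hθ.isOrdinal
  obtain ⟨hff, hfA, hfs⟩ := hf
  -- The given set is kept in cofinality `θ` and the essential set is taken in larger cofinality.
  -- Both are determined by `d`, so replacement yields the whole sequence without choice.
  obtain ⟨S, hS, hSm⟩ := exists_function l (fun d c => ∃ k, k ∈ A ∧ IsCofinality k d ∧
    (k = θ ∧ Maps C d c ∨ k ≠ θ ∧ IsEssentialSet C θ d c)) (by
    rintro d - c c' ⟨k, -, hk, h⟩ ⟨k', -, hk', h'⟩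
    obtain rfl := hk.unique hk'
    rcases h with ⟨e, h⟩ | ⟨e, h⟩ <;> rcases h' with ⟨e', h'⟩ | ⟨e', h'⟩
    · exact hC.isFunction.2 d c c' h h'
    · exact (e' e).elim
    · exact (e e').elim
    · exact ext fun z => (h z).trans (h' z).symm)
  refine ⟨S, hS, fun d => ⟨?_, ?_⟩, fun d c k n hdc hk hkn => ?_⟩
  · rintro ⟨c, hc⟩
    obtain ⟨hd, k, hkA, hk, -⟩ := (hSm d c).1 hc
    obtain ⟨n, hn⟩ := (hfA k).1 hkA
    exact ⟨hd, k, n, hk, hn⟩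
  · rintro ⟨hd, k, n, hk, hn⟩
    have hkA := (hfA k).2 ⟨n, hn⟩
    by_cases e : k = θ
    · obtain ⟨c, hc⟩ := hC.exists_maps d hd (e ▸ hk)
      exact ⟨c, (hSm d c).2 ⟨hd, k, hkA, hk, Or.inl ⟨e, hc⟩⟩⟩
    · obtain ⟨c, hc⟩ := exists_sep d (fun y => ∀ x, x ∈ y → ¬ IsNull C θ d x y)
      exact ⟨c, (hSm d c).2 ⟨hd, k, hkA, hk, Or.inr ⟨e, hc⟩⟩⟩
  · obtain ⟨hd, k', hkA, hk', h⟩ := (hSm d c).1 hdc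
    obtain rfl := hk.unique hk'
    obtain ⟨hkr, hθk, -⟩ := (hA k).1 hkA
    have hsucc := hfs k n hkn
    have hord : IsCofinalIn c d → ∀ x, x ∈ c → IsOrdinal x := fun h x hx =>
      (hl.mem hd).mem (h.1 x hx)
    rcases h with ⟨rfl, h⟩ | ⟨e, h⟩
    · have hcd := hC.isCofinalIn d c h
      exact ⟨hcd, exists_orderType_mem_succ (hord hcd) (hC.inj d c h) hsucc⟩
    · have hθk := hθk.resolve_left fun h => e h.symm
      have hcd := h.isCofinalIn hl hC hθ hDC hkr hθk hd hk
      exact ⟨hcd, exists_orderType_mem_succ (hord hcd) (h.inj hl hC hkr hθk hd hk hcd) hsucc⟩
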